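/- Let $(\Omega,\mu)$ be a $\sigma$-finite measure space with non-atomic $\mu$; functions on $\Omega$ are (classes of) $\mu$-measurable real- or complex-valued functions, and $f^*(t)=\inf\{s\ge 0:\mu(\{|f|>s\})\le t\}$ is the non-increasing rearrangement of $f$. Write $\|\cdot\|_{q,(c,d)}$ for the (quasi-)norm of $L_q(c,d)$, $0<q\le\infty$, with $1/\infty=0$. A positive Lebesgue measurable function $b$ on $(0,\infty)$ is slowly varying ($b\in SV$) if for every $\varepsilon>0$ the function $t^{\varepsilon}b(t)$ is equivalent (up to multiplicative constants) to an increasing function and $t^{-\varepsilon}b(t)$ to a decreasing one. For $0<p,q,r,s\le\infty$ and $a,b,c\in SV$ define the following spaces by finiteness of the indicated quasi-norms: $$\|f\|_{L_{p,q;a}}=\big\|t^{\frac1p-\frac1q}a(t)f^*(t)\big\|_{q,(0,\infty)},\qquad \|f\|_{L^{\mathcal R}_{p,r,b,q,a}}=\Big\|t^{-\frac1r}b(t)\big\|u^{\frac1p-\frac1q}a(u)f^*(u)\big\|_{q,(t,\infty)}\Big\|_{r,(0,\infty)},$$ $$\|f\|_{L^{\mathcal R,\mathcal L}_{p,(s,c,r,b,q,a)}}=\bigg\|t^{-\frac1s}c(t)\Big\|u^{-\frac1r}b(u)\big\|v^{\frac1p-\frac1q}a(v)f^*(v)\big\|_{q,(u,t)}\Big\|_{r,(0,t)}\bigg\|_{s,(0,\infty)},$$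 and let $L^{p),q,r}_{b}=L^{\mathcal R}_{p,r,b,q,1}$ be the grand Lorentz–Karamata space. For a couple $(A_0,A_1)$ of such spaces, $0\le\theta\le1$, $0<q\le\infty$ and $a\in SV$, the space $(A_0,A_1)_{\theta,q;a}$ consists of all $f\in A_0+A_1$ with $\|t^{-\theta-\frac1q}a(t)K(t,f)\|_{q,(0,\infty)}<\infty$, where $K(t,f)=\inf\{\|f_0\|_{A_0}+t\|f_1\|_{A_1}: f=f_0+f_1,\ f_i\in A_i\}$. Equality of spaces means equality as sets with equivalence of quasi-norms. Let $0<p_0<\infty$, $0<r,r_0,q_0\le\infty$ and $a,a_0,b_0\in SV$, with $\|u^{-1/r_0}b_0(u)\|_{r_0,(0,1)}<\infty$. Let $\chi(t)=a_0(t)\|u^{-1/r_0}b_0(u)\|_{r_0,(0,t)}$ and $\rho(t)=t^{1/p_0}\chi(t)$ for $t>0$. (i) If $\|u^{-1/r}a(u)\|_{r,(1,\infty)}<\infty$, then $\big(L^{\mathcal R}_{p_0,r_0,b_0,q_0,a_0},L_\infty\big)_{0,r;a}=L^{\mathcal R,\mathcal L}_{p_0,(r,a\circ\rho,r_0,b_0,q_0,a_0)}$.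 (ii) If $0<\theta<1$, then $\big(L^{\mathcal R}_{p_0,r_0,b_0,q_0,a_0},L_\infty\big)_{\theta,r;a}=L_{p,r;a^\#}$, where $\frac1p=\frac{1-\theta}{p_0}$ and $a^\#=\chi^{1-\theta}\cdot(a\circ\rho)$. (iii) If $\|u^{-1/r}a(u)\|_{r,(0,1)}<\infty$, then $\big(L^{\mathcal R}_{p_0,r_0,b_0,q_0,a_0},L_\infty\big)_{1,r;a}=L_{\infty,r;a\circ\rho}$. Moreover, if $\chi$ is replaced by $\chi(t)=\|u^{-1/r_0}b_0(u)\|_{r_0,(0,t)}$ (and $\rho(t)=t^{1/p_0}\chi(t)$ accordingly), then under the same respective conditions $\big(L^{p_0),q_0,r_0}_{b_0},L_\infty\big)_{\theta,r;a}$ equals $L^{\mathcal R,\mathcal L}_{p_0,(r,a\circ\rho,r_0,b_0,q_0,1)}$ for $\theta=0$, $L_{p,r;a^\#}$ with $\frac1p=\frac{1-\theta}{p_0}$, $a^\#=\chi^{1-\theta}\cdot(a\circ\rho)$ for $0<\theta<1$, and $L_{\infty,r;a\circ\rho}$ for $\theta=1$. -/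

import Mathlib

open MeasureTheory Set
open scoped ENNReal NNReal

noncomputable section

namespace LorentzKaramata

/-- The Lebesgue (quasi-)norm `‖g‖_{q, s}` of a `[0, ∞]`-valued function on a set `s` of reals. -/
def lqNorm (q : ℝ≥0∞) (s : Set ℝ) (g : ℝ → ℝ≥0∞) : ℝ≥0∞ :=
  eLpNorm g q (volume.restrict s)

/-- The real number `1 / q` for `0 < q ≤ ∞`, with `1 / ∞ = 0`. -/
def recip (q : ℝ≥0∞) : ℝ := (q⁻¹).toReal

/-- The power weight `t ^ α * b t`, as an extended nonnegative number. -/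
def weight (α : ℝ) (b : ℝ → ℝ) (t : ℝ) : ℝ≥0∞ := ENNReal.ofReal (t ^ α * b t)

/-- Equivalence `f ≈ g` of functions on `(0, ∞)`. -/
def EquivOn (f g : ℝ → ℝ) : Prop :=
  ∃ C : ℝ, 0 < C ∧ ∀ t : ℝ, 0 < t → f t ≤ C * g t ∧ g t ≤ C * f t

/-- Slowly varying functions on `(0, ∞)`; the values of `b` outside `(0, ∞)` are irrelevant. -/
structure SlowlyVarying (b : ℝ → ℝ) : Prop where
  measurable : AEMeasurable b (volume.restrict (Ioi 0))
  pos : ∀ t : ℝ, 0 < t → 0 < b t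
  equiv_increasing : ∀ ε : ℝ, 0 < ε →
    ∃ g : ℝ → ℝ, MonotoneOn g (Ioi 0) ∧ EquivOn (fun t => t ^ ε * b t) g
  equiv_decreasing : ∀ ε : ℝ, 0 < ε →
    ∃ g : ℝ → ℝ, AntitoneOn g (Ioi 0) ∧ EquivOn (fun t => t ^ (-ε) * b t) g

/-- A measure without atoms: every measurable set of positive measure has a measurable subset of
strictly smaller positive measure. -/
def NonAtomic {Ω : Type*} [MeasurableSpace Ω] (μ : Measure Ω) : Prop :=
  ∀ A : Set Ω, MeasurableSet A → 0 < μ A →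
    ∃ B : Set Ω, B ⊆ A ∧ MeasurableSet B ∧ 0 < μ B ∧ μ B < μ A

section Spaces

variable {Ω : Type*} [MeasurableSpace Ω] {μ : Measure Ω} {𝕜 : Type*} [RCLike 𝕜]

/-- The non-increasing rearrangement
`f^*(t) = inf {s ≥ 0 : μ {x : |f x| > s} ≤ t}` (the infimum of no finite `s` being `∞`). -/
def rearr (f : Ω →ₘ[μ] 𝕜) (t : ℝ) : ℝ≥0∞ :=
  sInf {s : ℝ≥0∞ | μ {x | s < ‖f x‖ₑ} ≤ ENNReal.ofReal t}

variable (μ 𝕜) in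
/-- A space of (classes of) measurable scalar functions together with its quasi-norm. -/
structure FunSpace where
  carrier : Set (Ω →ₘ[μ] 𝕜)
  qnorm : (Ω →ₘ[μ] 𝕜) → ℝ≥0∞

/-- The space of all measurable functions for which the functional `N` is finite. -/
def FunSpace.ofNorm (N : (Ω →ₘ[μ] 𝕜) → ℝ≥0∞) : FunSpace μ 𝕜 where
  carrier := {f | N f < ∞}
  qnorm := N

/-- Continuous embedding. -/
def FunSpace.Embeds (X Y : FunSpace μ 𝕜) : Prop :=
  X.carrier ⊆ Y.carrier ∧ ∃ C : ℝ≥0, ∀ f ∈ X.carrier, Y.qnorm f ≤ C * X.qnorm f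

/-- Equality of spaces: they have the same elements, with equivalent quasi-norms. -/
def FunSpace.Same (X Y : FunSpace μ 𝕜) : Prop :=
  X.Embeds Y ∧ Y.Embeds X

/-- Peetre's `K`-functional. -/
def Kfun (A₀ A₁ : FunSpace μ 𝕜) (t : ℝ) (f : Ω →ₘ[μ] 𝕜) : ℝ≥0∞ :=
  ⨅ (f₀ ∈ A₀.carrier) (f₁ ∈ A₁.carrier) (_ : f = f₀ + f₁),
    A₀.qnorm f₀ + ENNReal.ofReal t * A₁.qnorm f₁

/-- The quasi-norm `‖t^{-θ-1/q} a(t) K(t,f)‖_{q,(0,∞)}`. -/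
def interpNorm (A₀ A₁ : FunSpace μ 𝕜) (θ : ℝ) (q : ℝ≥0∞) (a : ℝ → ℝ) (f : Ω →ₘ[μ] 𝕜) : ℝ≥0∞ :=
  lqNorm q (Ioi 0) fun t => weight (-θ - recip q) a t * Kfun A₀ A₁ t f

/-- The real interpolation space `(A₀, A₁)_{θ,q;a}`. -/
def interp (A₀ A₁ : FunSpace μ 𝕜) (θ : ℝ) (q : ℝ≥0∞) (a : ℝ → ℝ) : FunSpace μ 𝕜 where
  carrier := {f | (∃ f₀ ∈ A₀.carrier, ∃ f₁ ∈ A₁.carrier, f = f₀ + f₁) ∧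
    interpNorm A₀ A₁ θ q a f < ∞}
  qnorm := interpNorm A₀ A₁ θ q a

variable (μ 𝕜)

/-- `L_∞`. -/
def Linf : FunSpace μ 𝕜 := .ofNorm fun f => eLpNorm f ∞ μ

/-- The Lorentz–Karamata space `L_{p,q;a}`. -/
def LK (p q : ℝ≥0∞) (a : ℝ → ℝ) : FunSpace μ 𝕜 := .ofNorm fun f =>
  lqNorm q (Ioi 0) fun t => weight (recip p - recip q) a t * rearr f t

/-- The `𝓡` Lorentz–Karamata space `L^𝓡_{p,r,b,q,a}`. -/
def LR (p r : ℝ≥0∞) (b : ℝ → ℝ) (q : ℝ≥0∞) (a : ℝ → ℝ) : FunSpace μ 𝕜 := .ofNorm fun f =>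
  lqNorm r (Ioi 0) fun t => weight (-recip r) b t *
    lqNorm q (Ioi t) fun u => weight (recip p - recip q) a u * rearr f u

/-- The `𝓡𝓛` Lorentz–Karamata space `L^{𝓡,𝓛}_{p,(s,c,r,b,q,a)}`. -/
def LRL (p s : ℝ≥0∞) (c : ℝ → ℝ) (r : ℝ≥0∞) (b : ℝ → ℝ) (q : ℝ≥0∞) (a : ℝ → ℝ) :
    FunSpace μ 𝕜 := .ofNorm fun f =>
  lqNorm s (Ioi 0) fun t => weight (-recip s) c t *
    lqNorm r (Ioo 0 t) fun u => weight (-recip r) b u *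
      lqNorm q (Ioo u t) fun v => weight (recip p - recip q) a v * rearr f v

/-- The grand Lorentz–Karamata space `L^{p),q,r}_b`. -/
def grandLK (p q r : ℝ≥0∞) (b : ℝ → ℝ) : FunSpace μ 𝕜 := .ofNorm fun f =>
  lqNorm r (Ioi 0) fun t => weight (-recip r) b t *
    lqNorm q (Ioi t) fun u => ENNReal.ofReal (u ^ (recip p - recip q)) * rearr f u

end Spaces

/-- `‖u^{-1/r} b(u)‖_{r,(0,t)}` as a real number (it is used only where this is finite). -/
def headNorm (r : ℝ≥0∞) (b : ℝ → ℝ) (t : ℝ) : ℝ :=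
  (lqNorm r (Ioo 0 t) (weight (-recip r) b)).toReal

/-- `χ(t) = a(t) ‖u^{-1/r} b(u)‖_{r,(0,t)}`. -/
def chi (r : ℝ≥0∞) (b a : ℝ → ℝ) (t : ℝ) : ℝ := a t * headNorm r b t

/-- `ρ(t) = t^{1/p} χ(t)`. -/
def rho (p : ℝ≥0∞) (χ : ℝ → ℝ) (t : ℝ) : ℝ := t ^ recip p * χ t

end LorentzKaramata

end

noncomputable section

namespace LorentzKaramata

/-! ### Norms with values in `[0, ∞]` and functions of at most exponential variation -/

section

/-! Everything rests on a Holmstedt-type formula for the `K`-functional (`Kfun_equiv`): `K(ρ(t), f)`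
is equivalent to `J(t)`, the norm `‖u^{-1/r₀} b₀(u) ‖v^{1/p₀-1/q₀} a₀(v)
f*(v)‖_{q₀,(u,t)}‖_{r₀,(0,t)}`. For the upper bound, cut `f` at the level `f*(t)`: the large part
has a rearrangement vanishing beyond `t`, so its norm is at most `J(t)`, and the bounded part costs
`ρ(t) f*(t)`, which `J(t)` dominates because `f*` is non-increasing. For the lower bound, `(f₀ +
f₁)* ≤ f₀* + ‖f₁‖_∞`, and `J` of a constant is of order `ρ(t)` times that constant.

Substituting `t = ρ(s)` in the interpolation norm turns `K` into `J`. Since `ρ` is a positive power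
times a slowly varying function, possibly neither monotone nor continuous, the substitution is made
by discretization (`LinGrowth.eLpNorm_comp_equiv`). For `θ = 0` the result is the `𝓡𝓛` norm itself.
For every `θ > 0`, including `θ = 1`, the factor `ρ^{-θ}` decays like a power, and a Hardy-type
inequality (`eLpNorm_damped_sup_le`, used in `eLpNorm_weight_logJ_equiv`) lets `J(t)` be replaced by
`ρ(t) f*(t)`, which leaves a Lorentz–Karamata norm.

All estimates are made in the variable `x = log t`. There `dt/t` is Lebesgue measure, slow variation
means growth slower than every `e^{ε|x-y|}`, and multiplicative constants are written `eexp c`. -/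

/-- The real exponential with values in `[0, ∞]`. -/
def eexp (x : ℝ) : ℝ≥0∞ := ENNReal.ofReal (Real.exp x)

lemma eexp_add (x y : ℝ) : eexp (x + y) = eexp x * eexp y := by
  rw [eexp, Real.exp_add, ENNReal.ofReal_mul (Real.exp_pos _).le]; rfl

lemma eexp_zero : eexp 0 = 1 := by simp [eexp]

lemma eexp_mono {x y : ℝ} (h : x ≤ y) : eexp x ≤ eexp y :=
  ENNReal.ofReal_le_ofReal (Real.exp_le_exp.2 h)

lemma eexp_le_iff {x y : ℝ} : eexp x ≤ eexp y ↔ x ≤ y := by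
  rw [eexp, eexp, ENNReal.ofReal_le_ofReal_iff (Real.exp_pos _).le, Real.exp_le_exp]

lemma eexp_ne_zero (x : ℝ) : eexp x ≠ 0 := by
  simp [eexp, Real.exp_pos]

lemma eexp_ne_top (x : ℝ) : eexp x ≠ ∞ := ENNReal.ofReal_ne_top

lemma one_le_eexp {x : ℝ} (h : 0 ≤ x) : 1 ≤ eexp x := eexp_zero ▸ eexp_mono h

lemma eexp_mul_eexp_neg (x : ℝ) : eexp x * eexp (-x) = 1 := by
  rw [← eexp_add, add_neg_cancel, eexp_zero]

lemma eexp_rpow (x y : ℝ) : eexp x ^ y = eexp (y * x) := by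
  rw [eexp, ENNReal.ofReal_rpow_of_pos (Real.exp_pos _), ← Real.exp_mul, mul_comm x y]; rfl

lemma measurable_eexp : Measurable eexp := Real.measurable_exp.ennreal_ofReal

lemma exists_le_eexp {k : ℝ≥0∞} (hk : k ≠ ∞) : ∃ c : ℝ, 0 ≤ c ∧ k ≤ eexp c := by
  refine ⟨k.toReal, ENNReal.toReal_nonneg, ?_⟩
  rw [eexp, ← ENNReal.ofReal_toReal hk]
  refine ENNReal.ofReal_le_ofReal ?_
  rw [ENNReal.toReal_ofReal ENNReal.toReal_nonneg]
  linarith [Real.add_one_le_exp k.toReal]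

lemma le_eexp_mul_of_eexp_neg_mul_le {c : ℝ} {a b : ℝ≥0∞} (h : eexp (-c) * a ≤ b) :
    a ≤ eexp c * b := by
  calc a = eexp c * (eexp (-c) * a) := by rw [← mul_assoc, eexp_mul_eexp_neg, one_mul]
    _ ≤ _ := by gcongr

lemma eexp_log {x : ℝ} (hx : 0 < x) : eexp (Real.log x) = ENNReal.ofReal x := by
  rw [eexp, Real.exp_log hx]

section Norms

variable {α : Type*} [MeasurableSpace α] {ν : Measure α} {q : ℝ≥0∞} {f g : α → ℝ≥0∞}

lemma eLpNorm_mono_of_ae_le (h : ∀ᵐ x ∂ν, f x ≤ g x) : eLpNorm f q ν ≤ eLpNorm g q ν :=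
  eLpNorm_mono_enorm_ae (by simpa using h)

lemma eLpNorm_le_const_mul {k : ℝ≥0∞} (hk : k ≠ ∞) (h : ∀ᵐ x ∂ν, f x ≤ k * g x) :
    eLpNorm f q ν ≤ k * eLpNorm g q ν := by
  lift k to ℝ≥0 using hk
  exact eLpNorm_le_mul_eLpNorm_of_ae_le_mul' (by simpa using h) q

lemma le_eLpNorm_of_ae_le {k : ℝ≥0∞} (hq : q ≠ 0) (hν : 1 ≤ ν univ) (h : ∀ᵐ x ∂ν, k ≤ f x) :
    k ≤ eLpNorm f q ν := by
  have hν0 : ν ≠ 0 := by rintro rfl; simp at hν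
  calc k ≤ k * ν univ ^ (1 / q.toReal) := by
        refine le_mul_of_one_le_right' ?_
        simpa using ENNReal.rpow_le_rpow hν (z := 1 / q.toReal) (by positivity)
    _ = eLpNorm (fun _ => k) q ν := by rw [eLpNorm_const _ hq hν0, enorm_eq_self]
    _ ≤ _ := eLpNorm_mono_of_ae_le h

lemma eLpNorm_restrict_mono {s t : Set α} (h : s ⊆ t) :
    eLpNorm f q (ν.restrict s) ≤ eLpNorm f q (ν.restrict t) :=
  eLpNorm_mono_measure _ (Measure.restrict_mono h le_rfl)

end Norms

lemma eLpNorm_translate {q : ℝ≥0∞} (F : ℝ → ℝ≥0∞) (c : ℝ) {s : Set ℝ} (hs : MeasurableSet s) :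
    eLpNorm (fun x => F (x + c)) q (volume.restrict ((· + c) ⁻¹' s))
      = eLpNorm F q (volume.restrict s) := by
  have he : MeasurableEmbedding (fun x : ℝ => x + c) := measurableEmbedding_addRight c
  have := (MeasurableEmbedding.eLpNorm_map_measure (p := q)
    (μ := volume.restrict ((· + c) ⁻¹' s)) (g := F) he)
  rw [← Measure.restrict_map (measurable_add_const c) hs, map_add_right_eq_self] at this
  exact this.symm

/-- Translation invariance makes the bound uniform in the endpoint; integrability of the exponential
on a half-line covers every finite exponent, also below `1`. -/
lemma eLpNorm_exp_decay {δ : ℝ} (hδ : 0 < δ) (q : ℝ≥0∞) :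
    ∃ c : ℝ, 0 ≤ c ∧ ∀ x, eLpNorm (fun v => eexp (δ * (v - x))) q (volume.restrict (Iio x)) ≤ eexp c := by
  have key : eLpNorm (fun v => eexp (δ * v)) q (volume.restrict (Iio 0)) ≠ ∞ := by
    rcases eq_or_ne q 0 with rfl | hq0
    · simp
    rcases eq_or_ne q ∞ with rfl | hq
    · rw [eLpNorm_exponent_top]
      refine ne_top_of_le_ne_top ENNReal.one_ne_top (eLpNormEssSup_le_of_ae_enorm_bound ?_)
      filter_upwards [ae_restrict_mem measurableSet_Iio] with v hv
      rw [enorm_eq_self, ← eexp_zero]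
      exact eexp_mono (mul_nonpos_of_nonneg_of_nonpos hδ.le (le_of_lt hv))
    · have hq' := ENNReal.toReal_pos hq0 hq
      rw [eLpNorm_eq_lintegral_rpow_enorm_toReal hq0 hq]
      refine ENNReal.rpow_ne_top_of_nonneg (by positivity) ?_
      have h1 : IntegrableOn (fun x => Real.exp ((q.toReal * δ) * x)) (Iio 0) :=
        (integrableOn_exp_mul_Iic (by positivity) 0).mono_set Iio_subset_Iic_self
      refine ne_top_of_le_ne_top h1.lintegral_lt_top.ne (lintegral_mono fun x => ?_)
      rw [enorm_eq_self, eexp_rpow, ← mul_assoc]; rfl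
  obtain ⟨c, hc, h⟩ := exists_le_eexp key
  refine ⟨c, hc, fun x => ?_⟩
  have := eLpNorm_translate (q := q) (fun v => eexp (δ * v)) (-x) (measurableSet_Iio (a := (0:ℝ)))
  have hs : (fun v => v + -x) ⁻¹' (Iio (0:ℝ)) = Iio x := by ext v; simp
  rw [hs] at this
  simp only [sub_eq_add_neg]
  rw [this]; exact h

/-- A function on `ℝ` varying at most exponentially. -/
def Reg (g : ℝ → ℝ≥0∞) : Prop :=
  ∃ c E : ℝ, 0 ≤ c ∧ 0 ≤ E ∧ ∀ x y, g x ≤ eexp (c + E * |x - y|) * g y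

/-- Slow variation in the logarithmic variable. -/
structure SVLog (b : ℝ → ℝ≥0∞) : Prop where
  ne_zero : ∀ x, b x ≠ 0
  ne_top : ∀ x, b x ≠ ∞
  bound : ∀ ε : ℝ, 0 < ε → ∃ c : ℝ, 0 ≤ c ∧ ∀ x y, b x ≤ eexp (c + ε * |x - y|) * b y

lemma SVLog.reg {b : ℝ → ℝ≥0∞} (h : SVLog b) : Reg b := by
  obtain ⟨c, hc, H⟩ := h.bound 1 one_pos
  exact ⟨c, 1, hc, zero_le_one, H⟩

lemma SVLog.mul {a b : ℝ → ℝ≥0∞} (ha : SVLog a) (hb : SVLog b) : SVLog fun x => a x * b x := by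
  refine ⟨fun x => mul_ne_zero (ha.ne_zero x) (hb.ne_zero x),
    fun x => ENNReal.mul_ne_top (ha.ne_top x) (hb.ne_top x), fun ε hε => ?_⟩
  obtain ⟨c, hc, H⟩ := ha.bound (ε / 2) (by positivity)
  obtain ⟨d, hd, H'⟩ := hb.bound (ε / 2) (by positivity)
  refine ⟨c + d, by positivity, fun x y => ?_⟩
  calc a x * b x ≤ (eexp (c + ε / 2 * |x - y|) * a y) * (eexp (d + ε / 2 * |x - y|) * b y) :=
        mul_le_mul' (H x y) (H' x y)
    _ = eexp ((c + ε / 2 * |x - y|) + (d + ε / 2 * |x - y|)) * (a y * b y) := by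
        rw [mul_mul_mul_comm, ← eexp_add]
    _ = _ := by congr 2; ring

lemma Reg.mul {a b : ℝ → ℝ≥0∞} (ha : Reg a) (hb : Reg b) : Reg fun x => a x * b x := by
  obtain ⟨c, E, hc, hE, H⟩ := ha
  obtain ⟨d, F, hd, hF, H'⟩ := hb
  refine ⟨c + d, E + F, by positivity, by positivity, fun x y => ?_⟩
  calc a x * b x ≤ (eexp (c + E * |x - y|) * a y) * (eexp (d + F * |x - y|) * b y) :=
        mul_le_mul' (H x y) (H' x y)
    _ = eexp ((c + E * |x - y|) + (d + F * |x - y|)) * (a y * b y) := by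
        rw [mul_mul_mul_comm, ← eexp_add]
    _ = _ := by congr 2; ring

lemma reg_eexp (α : ℝ) : Reg fun x => eexp (α * x) := by
  refine ⟨0, |α|, le_rfl, abs_nonneg _, fun x y => ?_⟩
  rw [← eexp_add]
  refine eexp_mono ?_
  rw [← abs_mul]
  linarith [le_abs_self (α * (x - y))]

lemma Reg.comp {g : ℝ → ℝ≥0∞} (hg : Reg g) {R : ℝ → ℝ} {c E : ℝ} (hc : 0 ≤ c) (hE : 0 ≤ E)
    (hR : ∀ x y, |R x - R y| ≤ E * |x - y| + c) : Reg fun x => g (R x) := by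
  obtain ⟨d, F, hd, hF, H⟩ := hg
  refine ⟨d + F * c, F * E, by positivity, by positivity, fun x y => (H (R x) (R y)).trans ?_⟩
  refine mul_le_mul_left (eexp_mono ?_) _
  nlinarith [mul_le_mul_of_nonneg_left (hR x y) hF]

/-- The step version of a function. -/
def step {β : Type*} (g : ℝ → β) (x : ℝ) : β := g ⌊x⌋

lemma measurable_step {β : Type*} [MeasurableSpace β] (g : ℝ → β) : Measurable (step g) :=
  (measurable_from_top (f := fun n : ℤ => g n)).comp Int.measurable_floor

lemma abs_floor_sub_le (x : ℝ) : |(⌊x⌋ : ℝ) - x| ≤ 1 := by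
  rw [abs_le]; constructor <;> linarith [Int.floor_le x, Int.lt_floor_add_one x]

/-- Sampling at integers moves the argument by at most `1`. It supplies a measurable substitute for
weights not known to be measurable. -/
lemma Reg.step_equiv {g : ℝ → ℝ≥0∞} (hg : Reg g) :
    ∃ c : ℝ, 0 ≤ c ∧ ∀ x, step g x ≤ eexp c * g x ∧ g x ≤ eexp c * step g x := by
  obtain ⟨c, E, hc, hE, H⟩ := hg
  refine ⟨c + E, by positivity, fun x => ⟨(H ⌊x⌋ x).trans ?_, (H x ⌊x⌋).trans ?_⟩⟩
  · refine mul_le_mul_left ?_ _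
    exact eexp_mono (by nlinarith [abs_floor_sub_le x])
  · rw [abs_sub_comm]
    refine mul_le_mul_left ?_ _
    exact eexp_mono (by nlinarith [abs_floor_sub_le x])

/-- The quasi-triangle inequality is applied with the weight replaced by its measurable step
version. The constant does not depend on the measure, so the bound holds uniformly over all
intervals of integration. -/
lemma Reg.eLpNorm_mul_add_le {w : ℝ → ℝ≥0∞} (hw : Reg w) (q : ℝ≥0∞) :
    ∃ c : ℝ, 0 ≤ c ∧ ∀ (ν : Measure ℝ) (f g : ℝ → ℝ≥0∞), Measurable f → Measurable g →
      eLpNorm (fun x => w x * (f x + g x)) q ν ≤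
        eexp c * (eLpNorm (fun x => w x * f x) q ν + eLpNorm (fun x => w x * g x) q ν) := by
  obtain ⟨c, hc, H⟩ := hw.step_equiv
  obtain ⟨d, hd, hdq⟩ := exists_le_eexp (ENNReal.LpAddConst_lt_top q).ne
  refine ⟨c + d + c, by positivity, fun ν f g hf hg => ?_⟩
  have key : ∀ f : ℝ → ℝ≥0∞, eLpNorm (fun x => step w x * f x) q ν ≤
      eexp c * eLpNorm (fun x => w x * f x) q ν := fun f =>
    eLpNorm_le_const_mul (eexp_ne_top _) (.of_forall fun x => by
      rw [← mul_assoc]; gcongr; exact (H x).1)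
  calc _ ≤ eexp c * eLpNorm ((fun x => step w x * f x) + fun x => step w x * g x) q ν := by
        refine eLpNorm_le_const_mul (eexp_ne_top _) (.of_forall fun x => ?_)
        simp only [Pi.add_apply]
        rw [← mul_add, ← mul_assoc]; gcongr; exact (H x).2
    _ ≤ eexp c * (eexp d * (eexp c * eLpNorm (fun x => w x * f x) q ν
          + eexp c * eLpNorm (fun x => w x * g x) q ν)) := by
        gcongr
        refine (eLpNorm_add_le' ((measurable_step w).mul hf).aestronglyMeasurable
          ((measurable_step w).mul hg).aestronglyMeasurable q).trans ?_
        gcongr <;> exact key _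
    _ = _ := by rw [eexp_add, eexp_add]; ring

end

/-! ### The iterated norm: pointwise bounds and quasi-additivity -/

section

/-- A finite nonzero constant is moved out by dividing it back. For `k = ∞` the integrand is `∞`
throughout, because `g` never vanishes, on a space of mass at least `1`. -/
lemma const_mul_eLpNorm_le_of_ne_zero {α : Type*} [MeasurableSpace α] {ν : Measure α}
    {q : ℝ≥0∞} {g : α → ℝ≥0∞} (hq : q ≠ 0) (hν : 1 ≤ ν univ) (hg : ∀ x, g x ≠ 0) (k : ℝ≥0∞) :
    k * eLpNorm g q ν ≤ eLpNorm (fun x => g x * k) q ν := by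
  rcases eq_or_ne k 0 with rfl | hk0
  · simp
  rcases eq_or_ne k ∞ with rfl | hk
  · refine le_top.trans (le_eLpNorm_of_ae_le hq hν (.of_forall fun x => ?_))
    rw [ENNReal.mul_top (hg x)]
  · have := eLpNorm_le_const_mul (ν := ν) (q := q) (f := g) (g := fun x => g x * k)
      (ENNReal.inv_ne_top.2 hk0) (.of_forall fun x => by
        rw [mul_comm (g x), ← mul_assoc, ENNReal.inv_mul_cancel hk0 hk, one_mul])
    calc _ ≤ k * (k⁻¹ * eLpNorm (fun x => g x * k) q ν) := by gcongr
      _ = _ := by rw [← mul_assoc, ENNReal.mul_inv_cancel hk0 hk, one_mul]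

lemma volume_restrict_Ioo_unit (x : ℝ) : 1 ≤ (volume.restrict (Ioo (x - 1) x)) univ := by
  simp

/-- The norm of `b` over `(-∞, x)`. -/
def logHead (r : ℝ≥0∞) (b : ℝ → ℝ≥0∞) (x : ℝ) : ℝ≥0∞ := eLpNorm b r (volume.restrict (Iio x))

/-- Translating one half-line onto another changes `b` only by its slow-variation factor, so the
head norm inherits the bound. Finiteness spreads from the point `0`, that is `t = 1`. -/
lemma SVLog.logHead {r : ℝ≥0∞} {b : ℝ → ℝ≥0∞} (hb : SVLog b) (hr : r ≠ 0)
    (hfin : logHead r b 0 ≠ ∞) : SVLog (logHead r b) := by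
  have bound : ∀ ε : ℝ, 0 < ε → ∃ c : ℝ, 0 ≤ c ∧ ∀ x y,
      LorentzKaramata.logHead r b x ≤
        eexp (c + ε * |x - y|) * LorentzKaramata.logHead r b y := by
    intro ε hε
    obtain ⟨c, hc, H⟩ := hb.bound ε hε
    refine ⟨c, hc, fun x y => ?_⟩
    have h1 := eLpNorm_translate (q := r) b (x - y) (measurableSet_Iio (a := x))
    have hs : (fun u => u + (x - y)) ⁻¹' (Iio x) = Iio y := by
      ext u; simp only [mem_preimage, mem_Iio]; constructor <;> intro h <;> linarith
    rw [hs] at h1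
    rw [LorentzKaramata.logHead, ← h1]
    refine eLpNorm_le_const_mul (eexp_ne_top _) (.of_forall fun u => ?_)
    simpa using H (u + (x - y)) u
  refine ⟨fun x h0 => ?_, fun x => ?_, bound⟩
  · obtain ⟨c, hc, H⟩ := hb.bound 1 one_pos
    have : eexp (-(c + 1)) * b x ≤ LorentzKaramata.logHead r b x := by
      refine le_trans ?_ (eLpNorm_restrict_mono (s := Ioo (x - 1) x) fun y hy => hy.2)
      refine le_eLpNorm_of_ae_le hr (volume_restrict_Ioo_unit x) ?_
      filter_upwards [ae_restrict_mem measurableSet_Ioo] with v hv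
      calc eexp (-(c + 1)) * b x ≤ eexp (-(c + 1)) * (eexp (c + 1) * b v) := by
            gcongr
            refine (H x v).trans (mul_le_mul_left (eexp_mono ?_) _)
            rw [abs_of_pos (by linarith [hv.2])]; linarith [hv.1]
        _ = b v := by rw [← mul_assoc, mul_comm (eexp _), eexp_mul_eexp_neg, one_mul]
    rw [h0, nonpos_iff_eq_zero] at this
    exact (mul_ne_zero (eexp_ne_zero _) (hb.ne_zero x)) this
  · obtain ⟨c, hc, H⟩ := bound 1 one_pos
    exact ne_top_of_le_ne_top (ENNReal.mul_ne_top (eexp_ne_top _) hfin) (H x 0)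

/-- The iterated norm `‖b(u) ‖w h‖_{q,(u,x)}‖_{r,(-∞,x)}`. -/
def logJ (r q : ℝ≥0∞) (b w h : ℝ → ℝ≥0∞) (x : ℝ) : ℝ≥0∞ :=
  eLpNorm (fun u => b u * eLpNorm (fun v => w v * h v) q (volume.restrict (Ioo u x))) r
    (volume.restrict (Iio x))

variable {r q : ℝ≥0∞} {b w : ℝ → ℝ≥0∞}

lemma logJ_mono {h h' : ℝ → ℝ≥0∞} {x : ℝ} (hh : ∀ v, h v ≤ h' v) :
    logJ r q b w h x ≤ logJ r q b w h' x := by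
  refine eLpNorm_mono_of_ae_le (.of_forall fun u => ?_)
  gcongr
  refine eLpNorm_mono_of_ae_le (.of_forall fun v => ?_)
  gcongr
  exact hh v

/-- Half of the rate `δ` pays for replacing `logHead r b v` by its value at `x`; the other half
makes `w h` decay exponentially to the left of `x`. The inner norm is then at most a constant times
`M / logHead r b x`, uniformly in `u`, and the outer norm of `b` restores the head norm. -/
lemma logJ_le_eexp_mul (hH : SVLog (logHead r b)) {δ : ℝ} (hδ : 0 < δ) :
    ∃ c : ℝ, 0 ≤ c ∧ ∀ (w h : ℝ → ℝ≥0∞) (x : ℝ) (M : ℝ≥0∞),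
      (∀ v < x, eexp (δ * (x - v)) * (w v * logHead r b v * h v) ≤ M) →
      logJ r q b w h x ≤ eexp c * M := by
  obtain ⟨c, hc, hcb⟩ := hH.bound (δ / 2) (by positivity)
  obtain ⟨d, hd, hdb⟩ := eLpNorm_exp_decay (δ := δ / 2) (by positivity) q
  refine ⟨c + d, by positivity, fun w h x M hM => ?_⟩
  rcases eq_or_ne M ∞ with rfl | hMt
  · rw [ENNReal.mul_top (eexp_ne_zero _)]; exact le_top
  set Hx := logHead r b x with hHx
  have hx0 : Hx ≠ 0 := hH.ne_zero x
  have hxt : Hx ≠ ∞ := hH.ne_top x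
  set k : ℝ≥0∞ := Hx⁻¹ * M * eexp c with hk
  have hkt : k ≠ ∞ :=
    ENNReal.mul_ne_top (ENNReal.mul_ne_top (ENNReal.inv_ne_top.2 hx0) hMt) (eexp_ne_top _)
  have pt : ∀ v < x, w v * h v ≤ k * eexp (δ / 2 * (v - x)) := by
    intro v hv
    have h1 : Hx * (w v * h v) ≤ eexp c * eexp (δ / 2 * (v - x)) * M := by
      have h2 := hcb x v
      rw [abs_of_pos (sub_pos.2 hv)] at h2
      calc Hx * (w v * h v) ≤ eexp (c + δ / 2 * (x - v)) * logHead r b v * (w v * h v) := by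
            gcongr
        _ = eexp (c + δ / 2 * (v - x)) * (eexp (δ * (x - v)) * (w v * logHead r b v * h v)) := by
            have : c + δ / 2 * (x - v) = (c + δ / 2 * (v - x)) + δ * (x - v) := by ring
            rw [this, eexp_add (c + δ / 2 * (v - x))]
            generalize eexp (c + δ / 2 * (v - x)) = X
            generalize eexp (δ * (x - v)) = Y
            ring
        _ ≤ eexp (c + δ / 2 * (v - x)) * M := by gcongr; exact hM v hv
        _ = _ := by rw [eexp_add]
    calc w v * h v = Hx⁻¹ * (Hx * (w v * h v)) := by
          rw [← mul_assoc, ENNReal.inv_mul_cancel hx0 hxt, one_mul]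
      _ ≤ Hx⁻¹ * (eexp c * eexp (δ / 2 * (v - x)) * M) := by gcongr
      _ = _ := by rw [hk]; generalize eexp (δ / 2 * (v - x)) = X; ring
  have inner : ∀ u, eLpNorm (fun v => w v * h v) q (volume.restrict (Ioo u x)) ≤ k * eexp d := by
    intro u
    calc _ ≤ k * eLpNorm (fun v => eexp (δ / 2 * (v - x))) q (volume.restrict (Ioo u x)) := by
          refine eLpNorm_le_const_mul hkt ?_
          filter_upwards [ae_restrict_mem measurableSet_Ioo] with v hv using pt v hv.2
      _ ≤ _ := by
          gcongr
          exact (eLpNorm_restrict_mono fun y hy => hy.2).trans (hdb x)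
  calc logJ r q b w h x ≤ (k * eexp d) * logHead r b x := by
        refine eLpNorm_le_const_mul (ENNReal.mul_ne_top hkt (eexp_ne_top _))
          (.of_forall fun u => ?_)
        rw [mul_comm (b u)]; gcongr; exact inner u
    _ = (Hx⁻¹ * Hx) * (eexp c * eexp d * M) := by rw [← hHx, hk]; ring
    _ = _ := by rw [ENNReal.inv_mul_cancel hx0 hxt, one_mul, eexp_add]

/-- On `(x - 1, x)` monotonicity of `h` and regularity of `w` keep `w h` above a multiple of its
value at `x`. Every inner norm with `u < x - 1` contains this interval, and the head norm loses only
a constant between `x` and `x - 1`. -/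
lemma le_eexp_mul_logJ (hr : r ≠ 0) (hq : q ≠ 0) (hb : ∀ x, b x ≠ 0) (hH : Reg (logHead r b))
    (hw : Reg w) :
    ∃ c : ℝ, 0 ≤ c ∧ ∀ (h : ℝ → ℝ≥0∞) (x : ℝ), Antitone h →
      w x * logHead r b x * h x ≤ eexp c * logJ r q b w h x := by
  obtain ⟨c, E, hc, hE, hcb⟩ := hw
  obtain ⟨d, F, hd, hF, hdb⟩ := hH
  refine ⟨(c + E) + (d + F), by positivity, fun h x hh => ?_⟩
  set k := eexp (-(c + E)) * (w x * h x) with hk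
  have inner : ∀ u < x - 1, k ≤ eLpNorm (fun v => w v * h v) q (volume.restrict (Ioo u x)) := by
    intro u hu
    refine le_trans ?_ (eLpNorm_restrict_mono (s := Ioo (x - 1) x) fun y hy =>
      ⟨hu.trans hy.1, hy.2⟩)
    refine le_eLpNorm_of_ae_le hq (volume_restrict_Ioo_unit x) ?_
    filter_upwards [ae_restrict_mem measurableSet_Ioo] with v hv
    have h1 : w x ≤ eexp (c + E) * w v := by
      refine (hcb x v).trans (mul_le_mul_left (eexp_mono ?_) _)
      rw [abs_of_pos (by linarith [hv.2])]; nlinarith [hv.1]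
    calc k ≤ eexp (-(c + E)) * (eexp (c + E) * w v * h v) := by
          rw [hk]; gcongr; exact hh hv.2.le
      _ = (eexp (c + E) * eexp (-(c + E))) * (w v * h v) := by ring
      _ = _ := by rw [eexp_mul_eexp_neg, one_mul]
  have outer : k * logHead r b (x - 1) ≤ logJ r q b w h x := by
    calc _ ≤ eLpNorm (fun u => b u * k) r (volume.restrict (Iio (x - 1))) :=
          const_mul_eLpNorm_le_of_ne_zero hr (by simp) hb k
      _ ≤ eLpNorm (fun u => b u * eLpNorm (fun v => w v * h v) q (volume.restrict (Ioo u x))) r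
            (volume.restrict (Iio (x - 1))) := by
          refine eLpNorm_mono_of_ae_le ?_
          filter_upwards [ae_restrict_mem measurableSet_Iio] with u hu
          gcongr; exact inner u hu
      _ ≤ _ := eLpNorm_restrict_mono (Iio_subset_Iio (by linarith))
  have h2 : logHead r b x ≤ eexp (d + F) * logHead r b (x - 1) := by
    simpa using hdb x (x - 1)
  calc w x * logHead r b x * h x ≤ w x * (eexp (d + F) * logHead r b (x - 1)) * h x := by gcongr
    _ = eexp (d + F) * ((eexp (c + E) * eexp (-(c + E))) * (w x * h x)) * logHead r b (x - 1) := by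
        rw [eexp_mul_eexp_neg]; ring
    _ = eexp (c + E) * eexp (d + F) * (k * logHead r b (x - 1)) := by rw [hk]; ring
    _ ≤ _ := by rw [eexp_add (c + E)]; gcongr

lemma logJ_add_le (hb : Reg b) (hw : Reg w) (r q : ℝ≥0∞) :
    ∃ c : ℝ, 0 ≤ c ∧ ∀ (h h' : ℝ → ℝ≥0∞) (x : ℝ), Measurable h → Measurable h' →
      logJ r q b w (fun v => h v + h' v) x ≤ eexp c * (logJ r q b w h x + logJ r q b w h' x) := by
  obtain ⟨c, hc, H⟩ := hw.eLpNorm_mul_add_le q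
  obtain ⟨d, hd, H'⟩ := hb.eLpNorm_mul_add_le r
  refine ⟨c + d, by positivity, fun h h' x hm hm' => ?_⟩
  -- The inner norm is antitone in `u`, hence measurable whether or not `w` is.
  have meas : ∀ h : ℝ → ℝ≥0∞,
      Measurable fun u => eLpNorm (fun v => w v * h v) q (volume.restrict (Ioo u x)) := fun h =>
    Antitone.measurable fun u u' huu => eLpNorm_restrict_mono (Ioo_subset_Ioo_left huu)
  calc _ ≤ eexp c * eLpNorm (fun u => b u *
          (eLpNorm (fun v => w v * h v) q (volume.restrict (Ioo u x)) +
            eLpNorm (fun v => w v * h' v) q (volume.restrict (Ioo u x)))) r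
              (volume.restrict (Iio x)) := by
        refine eLpNorm_le_const_mul (eexp_ne_top _) (.of_forall fun u => ?_)
        rw [mul_left_comm]
        gcongr
        exact H _ _ _ hm hm'
    _ ≤ _ := by
        rw [eexp_add, mul_assoc]
        gcongr
        exact H' _ _ _ (meas h) (meas h')

end

/-! ### Substitutions of linear growth, by discretization -/

/-- `R` is increasing at a linear rate, up to bounded errors. -/
def LinGrowth (κ c : ℝ) (R : ℝ → ℝ) : Prop :=
  ∀ x y, x ≤ y → κ * (y - x) - c ≤ R y - R x ∧ R y - R x ≤ 3 * κ * (y - x) + c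

lemma LinGrowth.abs_sub_le {κ c : ℝ} {R : ℝ → ℝ} (h : LinGrowth κ c R) (hκ : 0 ≤ κ) (x y : ℝ) :
    |R x - R y| ≤ 3 * κ * |x - y| + c := by
  rcases le_total x y with hxy | hxy
  · have := h x y hxy
    rw [abs_of_nonpos (sub_nonpos.2 hxy), abs_le]
    constructor <;> nlinarith [mul_nonneg hκ (sub_nonneg.2 hxy)]
  · have := h y x hxy
    rw [abs_of_nonneg (sub_nonneg.2 hxy), abs_le]
    constructor <;> nlinarith [mul_nonneg hκ (sub_nonneg.2 hxy)]

lemma LinGrowth.comp_floor {κ c : ℝ} {R : ℝ → ℝ} (h : LinGrowth κ c R) (hκ : 0 ≤ κ) :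
    LinGrowth κ (c + 3 * κ) (step R) := by
  intro x y hxy
  have h1 := h ⌊x⌋ ⌊y⌋ (by exact_mod_cast Int.floor_mono hxy)
  have := Int.floor_le x
  have := Int.floor_le y
  have := Int.lt_floor_add_one x
  have := Int.lt_floor_add_one y
  simp only [step]
  constructor <;> nlinarith

/-- This replaces the intermediate value theorem for a possibly discontinuous `R`. A point of `{R ≤
m}` within `1` of its supremum and the point `1` beyond the supremum are less than `2` apart, so `R`
overshoots `m` by at most `6κ + c`. -/
lemma LinGrowth.exists_lt_le {κ c : ℝ} {R : ℝ → ℝ} (h : LinGrowth κ c R) (hκ : 0 < κ) (m : ℝ) :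
    ∃ y, m < R y ∧ R y ≤ m + 6 * κ + c := by
  set S := {x | R x ≤ m}
  have hne : S.Nonempty := by
    refine ⟨-(|R 0 - m - (-c)| / κ), ?_⟩
    have h1 := (h (-(|R 0 - m - (-c)| / κ)) 0 (by
      rw [neg_nonpos]; positivity)).1
    have h2 : κ * (0 - -(|R 0 - m - (-c)| / κ)) = |R 0 - m - (-c)| := by field_simp; ring
    rw [h2] at h1
    have := le_abs_self (R 0 - m - (-c))
    change _ ≤ m; linarith
  have hbd : BddAbove S := by
    refine ⟨max 0 ((m - R 0 + c) / κ), fun x hx => ?_⟩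
    rcases le_total x 0 with h0 | h0
    · exact le_max_of_le_left h0
    · refine le_max_of_le_right ?_
      rw [le_div_iff₀ hκ]
      have := (h 0 x h0).1
      have hx' : R x ≤ m := hx
      linarith
  obtain ⟨x, hx, hlt⟩ := exists_lt_of_lt_csSup hne (show sSup S - 1 < sSup S by linarith)
  refine ⟨sSup S + 1, ?_, ?_⟩
  · by_contra hcon
    have := le_csSup hbd (show sSup S + 1 ∈ S from not_lt.1 hcon)
    linarith
  · have hle := le_csSup hbd hx
    have h1 := (h x (sSup S + 1) (by linarith)).2
    have hx' : R x ≤ m := hx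
    nlinarith

lemma LinGrowth.volume_level {κ c : ℝ} {R : ℝ → ℝ} (h : LinGrowth κ c R) (hκ : 0 < κ)
    (hc : 0 ≤ c) {l : ℝ} (hl : 2 * (9 * κ + 2 * c) < l) (j : ℤ) :
    1 ≤ volume {x | ⌊R x / l⌋ = j} ∧
      volume {x | ⌊R x / l⌋ = j} ≤ ENNReal.ofReal (2 * ((l + c) / κ)) := by
  have hl0 : 0 < l := by nlinarith
  have mem : ∀ x, ⌊R x / l⌋ = j ↔ j * l ≤ R x ∧ R x < (j + 1) * l := fun x => by
    rw [Int.floor_eq_iff, le_div_iff₀ hl0, div_lt_iff₀ hl0]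
  constructor
  -- Start just above the middle of the band. The overshoot `6κ + c` and the change of at most `3κ +
  -- c` over `[y, y + 1]` fit into half the band exactly when `9κ + 2c` is below `l / 2`.
  · obtain ⟨y, hy1, hy2⟩ := h.exists_lt_le hκ ((j + 1 / 2) * l)
    calc (1 : ℝ≥0∞) = volume (Icc y (y + 1)) := by simp
      _ ≤ _ := by
        refine measure_mono fun x hx => (mem x).2 ?_
        have h1 := h y x hx.1
        have := hx.2
        have := hx.1
        constructor <;> nlinarith
  · rcases Set.eq_empty_or_nonempty {x | ⌊R x / l⌋ = j} with he | ⟨x₀, hx₀⟩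
    · rw [he]; simp
    set D := (l + c) / κ with hD
    have hDk : D * κ = l + c := by rw [hD]; field_simp
    calc _ ≤ volume (Icc (x₀ - D) (x₀ + D)) := by
          refine measure_mono fun x hx => ?_
          have e0 := (mem x₀).1 hx₀
          have e1 := (mem x).1 hx
          rcases le_total x₀ x with hxx | hxx
          · have h1 := (h x₀ x hxx).1
            have : (x - x₀) * κ ≤ D * κ := by nlinarith
            have := le_of_mul_le_mul_right this hκ
            constructor <;> linarith
          · have h1 := (h x x₀ hxx).1
            have : (x₀ - x) * κ ≤ D * κ := by nlinarith
            have := le_of_mul_le_mul_right this hκ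
            constructor <;> linarith
      _ = _ := by rw [Real.volume_Icc]; congr 1; ring

lemma measure_int_le {ν ν' : Measure ℤ} (h : ∀ j, ν {j} ≤ ν' {j}) : ν ≤ ν' := by
  refine Measure.le_iff.2 fun s hs => ?_
  rw [← Measure.tsum_indicator_apply_singleton ν s hs,
    ← Measure.tsum_indicator_apply_singleton ν' s hs]
  exact ENNReal.tsum_le_tsum fun j => indicator_le_indicator (h j)

/-- The pushforward of Lebesgue measure to `ℤ` has all atoms between `1` and a fixed constant, so it
is comparable with counting measure. -/
lemma LinGrowth.eLpNorm_level {κ c : ℝ} {R : ℝ → ℝ} (h : LinGrowth κ c R) (hR : Measurable R)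
    (hκ : 0 < κ) (hc : 0 ≤ c) {l : ℝ} (hl : 2 * (9 * κ + 2 * c) < l) (q : ℝ≥0∞) :
    ∃ d : ℝ, 0 ≤ d ∧ ∀ G : ℤ → ℝ≥0∞,
      eLpNorm (fun x => G ⌊R x / l⌋) q volume ≤ eexp d * eLpNorm G q Measure.count ∧
      eLpNorm G q Measure.count ≤ eLpNorm (fun x => G ⌊R x / l⌋) q volume := by
  have hm : Measurable fun x => ⌊R x / l⌋ := (hR.div_const l).floor
  set ν := Measure.map (fun x => ⌊R x / l⌋) volume with hν
  have hνj : ∀ j, ν {j} = volume {x | ⌊R x / l⌋ = j} := fun j => by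
    rw [hν, Measure.map_apply hm (measurableSet_singleton j)]; rfl
  have hG : ∀ G : ℤ → ℝ≥0∞, eLpNorm G q ν = eLpNorm (fun x => G ⌊R x / l⌋) q volume := fun G =>
    eLpNorm_map_measure (measurable_from_top (f := G)).aestronglyMeasurable hm.aemeasurable
  obtain ⟨m, hm0, hmM⟩ := exists_le_eexp (ENNReal.ofReal_ne_top (r := 2 * ((l + c) / κ)))
  obtain ⟨d, hd, hdM⟩ := exists_le_eexp
    (ENNReal.rpow_ne_top_of_nonneg (x := eexp m) (y := (1 / q).toReal)
      ENNReal.toReal_nonneg (eexp_ne_top _))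
  refine ⟨d, hd, fun G => ⟨?_, ?_⟩⟩
  · rw [← hG]
    have : ν ≤ eexp m • Measure.count := measure_int_le fun j => by
      rw [hνj]
      simpa using (h.volume_level hκ hc hl j).2.trans hmM
    refine (eLpNorm_mono_measure G this).trans ?_
    rw [eLpNorm_smul_measure_of_ne_zero (eexp_ne_zero _), smul_eq_mul]
    gcongr
  · rw [← hG]
    refine eLpNorm_mono_measure G (measure_int_le fun j => ?_)
    rw [hνj]
    simpa using (h.volume_level hκ hc hl j).1

lemma linGrowth_id : LinGrowth 1 0 id := fun x y hxy => by
  simp only [id]; constructor <;> linarith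

/-- A norm of a function of exponential variation is, up to constants, not changed by a
substitution of linear growth. -/
lemma LinGrowth.eLpNorm_comp_equiv {κ c : ℝ} {R : ℝ → ℝ} (h : LinGrowth κ c R) (hκ : 0 < κ)
    (hc : 0 ≤ c) (q : ℝ≥0∞) (C E : ℝ) (hC : 0 ≤ C) (hE : 0 ≤ E) :
    ∃ d : ℝ, 0 ≤ d ∧ ∀ Γ : ℝ → ℝ≥0∞, (∀ x y, Γ x ≤ eexp (C + E * |x - y|) * Γ y) →
      eLpNorm (fun x => Γ (R x)) q volume ≤ eexp d * eLpNorm Γ q volume ∧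
      eLpNorm Γ q volume ≤ eexp d * eLpNorm (fun x => Γ (R x)) q volume := by
  set c' := c + 3 * κ with hc'
  have h' := h.comp_floor hκ.le
  -- One mesh `l` serves both `step R` and the identity, so both norms are compared with the norm
  -- over `ℤ` of the same samples `Γ (l * j)`.
  obtain ⟨l, hl1, hl2⟩ : ∃ l : ℝ, 2 * (9 * κ + 2 * c') < l ∧ 2 * (9 * 1 + 2 * 0) < l :=
    ⟨max (2 * (9 * κ + 2 * c')) (2 * (9 * 1 + 2 * 0)) + 1,
      by linarith [le_max_left (2 * (9 * κ + 2 * c')) (2 * (9 * 1 + 2 * 0))],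
      by linarith [le_max_right (2 * (9 * κ + 2 * c')) (2 * (9 * 1 + 2 * 0))]⟩
  have hl : 0 < l := by linarith
  obtain ⟨d₁, hd₁, H₁⟩ := h'.eLpNorm_level (measurable_step R) hκ (by positivity) hl1 q
  obtain ⟨d₂, hd₂, H₂⟩ := linGrowth_id.eLpNorm_level measurable_id one_pos le_rfl hl2 q
  have near : ∀ x, |step R x - R x| ≤ c' := fun x => by
    have := h.abs_sub_le hκ.le ⌊x⌋ x
    have h2 := abs_floor_sub_le x
    simp only [step]
    nlinarith
  have lev : ∀ y : ℝ, |y - l * ⌊y / l⌋| ≤ l := fun y => by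
    have h1 := Int.floor_le (y / l)
    have h2 := Int.lt_floor_add_one (y / l)
    rw [le_div_iff₀ hl] at h1
    rw [div_lt_iff₀ hl] at h2
    rw [abs_le]; constructor <;> nlinarith
  set e := C + E * (c' + l) with he
  have he0 : 0 ≤ e := by positivity
  refine ⟨e + (d₁ + d₂) + e, by positivity, fun Γ hΓ => ?_⟩
  set G : ℤ → ℝ≥0∞ := fun j => Γ (l * j) with hG
  have cmp : ∀ x y, |x - y| ≤ c' + l → Γ x ≤ eexp e * Γ y := fun x y hxy => by
    refine (hΓ x y).trans (mul_le_mul_left (eexp_mono ?_) _)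
    rw [he]; gcongr
  have near2 : ∀ x, |R x - l * ⌊step R x / l⌋| ≤ c' + l := fun x => by
    have h1 := near x
    have h2 := lev (step R x)
    rw [abs_le] at *
    constructor <;> linarith
  have near3 : ∀ x : ℝ, |x - l * ⌊x / l⌋| ≤ c' + l := fun x =>
    (lev x).trans (by linarith [show 0 ≤ c' by positivity])
  have A1 : eLpNorm (fun x => Γ (R x)) q volume ≤
      eexp e * eLpNorm (fun x => G ⌊step R x / l⌋) q volume :=
    eLpNorm_le_const_mul (eexp_ne_top _) (.of_forall fun x => cmp _ _ (near2 x))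
  have A2 : eLpNorm (fun x => G ⌊step R x / l⌋) q volume ≤
      eexp e * eLpNorm (fun x => Γ (R x)) q volume :=
    eLpNorm_le_const_mul (eexp_ne_top _)
      (.of_forall fun x => cmp _ _ (by rw [abs_sub_comm]; exact near2 x))
  have B1 : eLpNorm Γ q volume ≤ eexp e * eLpNorm (fun x => G ⌊id x / l⌋) q volume :=
    eLpNorm_le_const_mul (eexp_ne_top _) (.of_forall fun x => cmp _ _ (near3 x))
  have B2 : eLpNorm (fun x => G ⌊id x / l⌋) q volume ≤ eexp e * eLpNorm Γ q volume :=
    eLpNorm_le_const_mul (eexp_ne_top _)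
      (.of_forall fun x => cmp _ _ (by rw [abs_sub_comm]; exact near3 x))
  constructor
  · calc _ ≤ eexp e * (eexp d₁ * (eexp e * eLpNorm Γ q volume)) := by
          refine A1.trans ?_
          gcongr
          refine (H₁ G).1.trans ?_
          gcongr
          exact (H₂ G).2.trans B2
      _ = eexp (e + d₁ + e) * eLpNorm Γ q volume := by
          rw [eexp_add (e + d₁) e, eexp_add e d₁]; ring
      _ ≤ _ := mul_le_mul_left (eexp_mono (by linarith)) _
  · calc _ ≤ eexp e * (eexp d₂ * (eexp e * eLpNorm (fun x => Γ (R x)) q volume)) := by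
          refine B1.trans ?_
          gcongr
          refine (H₂ G).1.trans ?_
          gcongr
          exact (H₁ G).2.trans A2
      _ = eexp (e + d₂ + e) * eLpNorm (fun x => Γ (R x)) q volume := by
          rw [eexp_add (e + d₂) e, eexp_add e d₂]; ring
      _ ≤ _ := mul_le_mul_left (eexp_mono (by linarith)) _

/-! ### The Hardy-type inequality and the collapse of the iterated norm for positive `θ` -/

/-- A Hardy-type inequality for exponentially damped suprema. -/
lemma eLpNorm_damped_sup_le {η : ℝ} (hη : 0 < η) {c : ℝ} {q : ℝ≥0∞} (hq : q ≠ 0) :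
    ∃ d : ℝ, 0 ≤ d ∧ ∀ F ψ : ℝ → ℝ≥0∞, Measurable ψ →
      (∀ v, ∀ s ∈ Ioo (v - 1) v, ψ v ≤ eexp c * ψ s) →
      (∀ x, F x ≤ ⨆ v ∈ Iio x, eexp (-η * (x - v)) * ψ v) →
      eLpNorm F q volume ≤ eexp d * eLpNorm ψ q volume := by
  rcases eq_or_ne q ∞ with rfl | hqt
  · refine ⟨|c|, abs_nonneg _, fun F ψ _ hψ hF => ?_⟩
    -- The supremum is over all points while the norm is an essential supremum; control on the unit
    -- interval before `v` bridges the two.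
    have h1 : ∀ v, ψ v ≤ eexp c * eLpNorm ψ ∞ volume := fun v => by
      refine le_eexp_mul_of_eexp_neg_mul_le ?_
      refine le_trans ?_ (eLpNorm_mono_measure ψ (Measure.restrict_le_self (s := Ioo (v - 1) v)))
      refine le_eLpNorm_of_ae_le hq (volume_restrict_Ioo_unit v) ?_
      filter_upwards [ae_restrict_mem measurableSet_Ioo] with s hs
      calc _ ≤ eexp (-c) * (eexp c * ψ s) := by gcongr; exact hψ v s hs
        _ = _ := by rw [← mul_assoc, mul_comm (eexp _), eexp_mul_eexp_neg, one_mul]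
    rw [eLpNorm_exponent_top (f := F)]
    refine eLpNormEssSup_le_of_ae_enorm_bound (.of_forall fun x => ?_)
    rw [enorm_eq_self]
    refine (hF x).trans (iSup₂_le fun v hv => ?_)
    calc eexp (-η * (x - v)) * ψ v ≤ 1 * (eexp c * eLpNorm ψ ∞ volume) := by
          gcongr
          · rw [← eexp_zero]
            exact eexp_mono (by nlinarith [show v < x from hv])
          · exact h1 v
      _ ≤ _ := by rw [one_mul]; exact mul_le_mul_left (eexp_mono (le_abs_self c)) _
  · have hp := ENNReal.toReal_pos hq hqt
    set p := q.toReal with hpdef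
    -- For finite `p`, `ψ(v)^p` is replaced by an integral over `(v - 1, v)`. The supremum is
    -- thereby bounded by a convolution of `ψ^p` with an integrable exponential, and Tonelli
    -- finishes without requiring `p ≥ 1`.
    set ker : ℝ → ℝ≥0∞ := (Ioi 0).indicator fun s => eexp (-(p * η) * s) with hker
    have hkm : Measurable ker :=
      (measurable_eexp.comp (measurable_const.mul measurable_id)).indicator measurableSet_Ioi
    have hkt : ∫⁻ s, ker s ≠ ∞ := by
      rw [hker, lintegral_indicator measurableSet_Ioi]
      exact (integrableOn_exp_mul_Ioi (a := -(p * η)) (by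
        rw [neg_lt_zero]; positivity) 0).lintegral_lt_top.ne
    obtain ⟨k, hk0, hk⟩ := exists_le_eexp hkt
    -- Moving from `v` to `s` costs `c` in `ψ` and at most `η` in the damping factor, both raised to
    -- the power `p`.
    set e := p * (c + η) with he
    refine ⟨|(e + k) * (1 / p)|, abs_nonneg _, fun F ψ hm hψ hF => ?_⟩
    have pt : ∀ x, F x ^ p ≤ eexp e * ∫⁻ s, ker (x - s) * ψ s ^ p := by
      intro x
      have : ∀ v ∈ Iio x, eexp (-η * (x - v)) * ψ v ≤
          (eexp e * ∫⁻ s, ker (x - s) * ψ s ^ p) ^ (1 / p) := by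
        intro v hv
        have hv' : v < x := hv
        rw [one_div, ENNReal.le_rpow_inv_iff hp]
        calc (eexp (-η * (x - v)) * ψ v) ^ p
            = ∫⁻ s in Ioo (v - 1) v, (eexp (-η * (x - v)) * ψ v) ^ p := by simp
          _ ≤ ∫⁻ s in Ioo (v - 1) v, eexp e * (ker (x - s) * ψ s ^ p) := by
              refine setLIntegral_mono' measurableSet_Ioo fun s hs => ?_
              have hks : ker (x - s) = eexp (-(p * η) * (x - s)) := by
                rw [hker, indicator_of_mem]
                exact sub_pos.2 (hs.2.trans hv')
              rw [hks]
              calc _ ≤ (eexp (-η * (x - v)) * (eexp c * ψ s)) ^ p := by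
                    gcongr; exact hψ v s hs
                _ = eexp (p * (-η * (x - v) + c)) * ψ s ^ p := by
                    rw [← mul_assoc, ← eexp_add, ENNReal.mul_rpow_of_nonneg _ _ hp.le, eexp_rpow]
                _ ≤ eexp (e + -(p * η) * (x - s)) * ψ s ^ p := by
                    refine mul_le_mul_left (eexp_mono ?_) _
                    have h3 : v - s ≤ 1 := by linarith [hs.1]
                    have := mul_le_mul_of_nonneg_left h3 (mul_pos hp hη).le
                    rw [he]; nlinarith
                _ = _ := by rw [eexp_add, mul_assoc]
          _ ≤ ∫⁻ s, eexp e * (ker (x - s) * ψ s ^ p) := setLIntegral_le_lintegral _ _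
          _ = _ := lintegral_const_mul' _ _ (eexp_ne_top _)
      have h2 := (hF x).trans (iSup₂_le this)
      rwa [one_div, ENNReal.le_rpow_inv_iff hp] at h2
    have tot : ∫⁻ x, F x ^ p ≤ eexp (e + k) * ∫⁻ s, ψ s ^ p := by
      calc ∫⁻ x, F x ^ p ≤ ∫⁻ x, eexp e * ∫⁻ s, ker (x - s) * ψ s ^ p := lintegral_mono pt
        _ = eexp e * ∫⁻ x, ∫⁻ s, ker (x - s) * ψ s ^ p :=
            lintegral_const_mul' _ _ (eexp_ne_top _)
        _ = eexp e * ∫⁻ s, ∫⁻ x, ker (x - s) * ψ s ^ p := by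
            rw [lintegral_lintegral_swap]
            refine Measurable.aemeasurable ?_
            exact (hkm.comp (measurable_fst.sub measurable_snd)).mul
              ((hm.comp measurable_snd).pow_const p)
        _ = eexp e * ∫⁻ s, (∫⁻ x, ker x) * ψ s ^ p := by
            congr 1
            refine lintegral_congr fun s => ?_
            rw [lintegral_mul_const (ψ s ^ p) (f := fun x => ker (x - s))
              (hkm.comp (measurable_id.sub_const s)), lintegral_sub_right_eq_self ker s]
        _ = eexp e * ((∫⁻ x, ker x) * ∫⁻ s, ψ s ^ p) := by
            rw [lintegral_const_mul _ (hm.pow_const p)]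
        _ ≤ _ := by rw [eexp_add, mul_assoc]; gcongr
    rw [eLpNorm_eq_lintegral_rpow_enorm_toReal hq hqt, eLpNorm_eq_lintegral_rpow_enorm_toReal hq hqt]
    simp only [enorm_eq_self, ← hpdef]
    calc _ ≤ (eexp (e + k) * ∫⁻ s, ψ s ^ p) ^ (1 / p) := by gcongr
      _ = eexp ((e + k) * (1 / p)) * (∫⁻ s, ψ s ^ p) ^ (1 / p) := by
          rw [ENNReal.mul_rpow_of_nonneg _ _ (by positivity), eexp_rpow, mul_comm (1 / p)]
      _ ≤ _ := mul_le_mul_left (eexp_mono (le_abs_self _)) _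

lemma SVLog.reg_eexp_mul {a : ℝ → ℝ≥0∞} (ha : SVLog a) (α : ℝ) :
    Reg fun x => eexp (α * x) * a x := (reg_eexp α).mul ha.reg

/-- The factor `eexp (-θ * R)` beats the slowly varying `a ∘ R`, whose growth is taken at rate `θ /
2`, leaving decay at rate `θκ / 2`. The term `2θ|c|` absorbs the bounded failures of monotonicity of
`R`. -/
lemma SVLog.damping {a : ℝ → ℝ≥0∞} (ha : SVLog a) {κ c : ℝ} {R : ℝ → ℝ} (hR : LinGrowth κ c R)
    (hκ : 0 ≤ κ) {θ : ℝ} (hθ : 0 < θ) :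
    ∃ m : ℝ, ∀ v x, v ≤ x → eexp (-θ * R x) * a (R x) ≤
      eexp (m - θ * κ / 2 * (x - v)) * (eexp (-θ * R v) * a (R v)) := by
  obtain ⟨d, hd, H⟩ := ha.bound (θ / 2) (by positivity)
  refine ⟨d + 2 * θ * |c|, fun v x hvx => ?_⟩
  have h1 := (hR v x hvx).1
  calc eexp (-θ * R x) * a (R x)
      ≤ eexp (-θ * R x) * (eexp (d + θ / 2 * |R x - R v|) * a (R v)) := by
        gcongr; exact H _ _
    _ = eexp (-θ * R x + (d + θ / 2 * |R x - R v|)) * a (R v) := by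
        rw [← mul_assoc, ← eexp_add]
    _ ≤ eexp (d + 2 * θ * |c| - θ * κ / 2 * (x - v) + -θ * R v) * a (R v) := by
        refine mul_le_mul_left (eexp_mono ?_) _
        have hc := le_abs_self c
        have hc' := mul_le_mul_of_nonneg_left hc hθ.le
        have h1' := mul_le_mul_of_nonneg_left h1 hθ.le
        rcases le_total (R v) (R x) with h2 | h2
        · rw [abs_of_nonneg (sub_nonneg.2 h2)]
          nlinarith [abs_nonneg c]
        · rw [abs_of_nonpos (sub_nonpos.2 h2)]
          have h3 := mul_nonneg hθ.le (mul_nonneg hκ (sub_nonneg.2 hvx))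
          nlinarith [abs_nonneg c]
    _ = _ := by rw [eexp_add _ (-θ * R v), mul_assoc]

/-- The weighted norms of `logJ h` and of `eexp R * h` are equivalent for weights which decay
exponentially. -/
lemma eLpNorm_weight_logJ_equiv {r₀ q₀ r : ℝ≥0∞} (hr₀ : r₀ ≠ 0) (hq₀ : q₀ ≠ 0) (hr : r ≠ 0)
    {b w a : ℝ → ℝ≥0∞} (hb : SVLog b) (hH : SVLog (logHead r₀ b)) (hw : Reg w) (ha : SVLog a)
    {κ c : ℝ} (hκ : 0 < κ) (hc : 0 ≤ c) {R : ℝ → ℝ} (hR : LinGrowth κ c R)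
    (hRw : ∀ x, eexp (R x) = w x * logHead r₀ b x) {θ : ℝ} (hθ : 0 < θ) :
    ∃ d : ℝ, 0 ≤ d ∧ ∀ h : ℝ → ℝ≥0∞, Antitone h →
      eLpNorm (fun x => eexp (-θ * R x) * a (R x) * logJ r₀ q₀ b w h x) r volume ≤
        eexp d * eLpNorm (fun x => eexp (-θ * R x) * a (R x) * (eexp (R x) * h x)) r volume ∧
      eLpNorm (fun x => eexp (-θ * R x) * a (R x) * (eexp (R x) * h x)) r volume ≤
        eexp d * eLpNorm (fun x => eexp (-θ * R x) * a (R x) * logJ r₀ q₀ b w h x) r volume := by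
  set W : ℝ → ℝ≥0∞ := fun x => eexp (-θ * R x) * a (R x) with hW
  -- The weight decays at rate `2δ`: one `δ` is spent on the growing factor in `logJ_le_eexp_mul`,
  -- the other remains as damping for the Hardy inequality.
  set δ := θ * κ / 4 with hδ
  have hδ0 : 0 < δ := by positivity
  obtain ⟨c₁, hc₁, H₁⟩ := logJ_le_eexp_mul (q := q₀) hH hδ0
  obtain ⟨c₂, hc₂, H₂⟩ := le_eexp_mul_logJ hr₀ hq₀ hb.ne_zero hH.reg hw
  obtain ⟨m, hm⟩ := ha.damping hR hκ.le hθ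
  have hP : Reg fun x => W x * eexp (R x) := by
    have h1 : Reg W := (ha.reg_eexp_mul (-θ)).comp hc (by positivity) (hR.abs_sub_le hκ.le)
    have h2 : Reg fun x => eexp (R x) := by
      simpa using (reg_eexp 1).comp hc (by positivity) (hR.abs_sub_le hκ.le)
    exact h1.mul h2
  obtain ⟨s, hs, Hs⟩ := hP.step_equiv
  obtain ⟨e, E, he, hE, HE⟩ := hP
  -- The constant pays for leaving the step version of the weight, crossing a unit interval, and
  -- returning to the step version.
  obtain ⟨d, hd, Hd⟩ := eLpNorm_damped_sup_le (η := δ) hδ0 (c := s + (e + E) + s) hr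
  set k := m + c₁ + s with hk
  refine ⟨c₂ + (d + |k + s|), by positivity, fun h hh => ⟨?_, ?_⟩⟩
  · set ψ : ℝ → ℝ≥0∞ := fun v => eexp k * (step (fun x => W x * eexp (R x)) v * h v) with hψ
    have key := Hd (fun x => W x * logJ r₀ q₀ b w h x) ψ
      (measurable_const.mul ((measurable_step _).mul hh.measurable)) ?_ ?_
    · calc _ ≤ eexp d * eLpNorm ψ r volume := key
        _ ≤ eexp d * (eexp (k + s) * eLpNorm (fun x => W x * (eexp (R x) * h x)) r volume) := by
            gcongr
            refine eLpNorm_le_const_mul (eexp_ne_top _) (.of_forall fun x => ?_)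
            rw [eexp_add k s, mul_assoc (eexp k), ← mul_assoc (W x), ← mul_assoc (eexp s)]
            refine mul_le_mul_right (mul_le_mul_left (Hs x).1 _) _
        _ ≤ _ := by
            rw [← mul_assoc, ← eexp_add]
            exact mul_le_mul_left (eexp_mono (by linarith [le_abs_self (k + s)])) _
    · intro v t ht
      have h1 : step (fun x => W x * eexp (R x)) v ≤
          eexp (s + (e + E) + s) * step (fun x => W x * eexp (R x)) t := by
        calc _ ≤ eexp s * (W v * eexp (R v)) := (Hs v).1
          _ ≤ eexp s * (eexp (e + E) * (W t * eexp (R t))) := by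
              refine mul_le_mul_right ((HE v t).trans (mul_le_mul_left (eexp_mono ?_) _)) _
              rw [abs_of_pos (by linarith [ht.2])]; nlinarith [ht.1]
          _ ≤ eexp s * (eexp (e + E) * (eexp s * step (fun x => W x * eexp (R x)) t)) := by
              exact mul_le_mul_right (mul_le_mul_right (Hs t).2 _) _
          _ = _ := by
              rw [eexp_add (s + (e + E)) s, eexp_add s (e + E)]
              generalize eexp (e + E) = X
              ring
      calc ψ v ≤ eexp k * (eexp (s + (e + E) + s) *
            step (fun x => W x * eexp (R x)) t * h t) := by
            exact mul_le_mul_right (mul_le_mul' h1 (hh ht.2.le)) _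
        _ = _ := by
            rw [hψ]; generalize eexp (s + (e + E) + s) = X; generalize eexp k = Y; ring
    · intro x
      -- The bound `M` is taken to be the supremum itself.
      have h1 := H₁ w h x (⨆ v ∈ Iio x, eexp (δ * (x - v)) * (w v * logHead r₀ b v * h v))
        fun v hv => le_iSup₂ (f := fun v (_ : v ∈ Iio x) =>
          eexp (δ * (x - v)) * (w v * logHead r₀ b v * h v)) v hv
      calc W x * logJ r₀ q₀ b w h x ≤ W x * (eexp c₁ *
            ⨆ v ∈ Iio x, eexp (δ * (x - v)) * (w v * logHead r₀ b v * h v)) := by gcongr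
        _ = ⨆ v ∈ Iio x, (W x * eexp c₁) *
              (eexp (δ * (x - v)) * (w v * logHead r₀ b v * h v)) := by
            rw [← mul_assoc, ENNReal.mul_iSup]
            refine iSup_congr fun v => ?_
            rw [ENNReal.mul_iSup]
        _ ≤ _ := by
            refine iSup₂_mono fun v hv => ?_
            rw [← hRw]
            have h2 : W x ≤ eexp (m - 2 * δ * (x - v)) * W v := by
              have := hm v x (le_of_lt hv)
              rwa [show θ * κ / 2 * (x - v) = 2 * δ * (x - v) by rw [hδ]; ring] at this
            calc W x * eexp c₁ * (eexp (δ * (x - v)) * (eexp (R v) * h v))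
                ≤ (eexp (m - 2 * δ * (x - v)) * W v) * eexp c₁ *
                    (eexp (δ * (x - v)) * (eexp (R v) * h v)) := by gcongr
              _ = (eexp (m - 2 * δ * (x - v)) * eexp c₁ * eexp (δ * (x - v))) *
                    ((W v * eexp (R v)) * h v) := by
                  generalize eexp (m - 2 * δ * (x - v)) = X
                  generalize eexp (δ * (x - v)) = Y
                  ring
              _ = (eexp (-δ * (x - v)) * eexp (m + c₁)) * ((W v * eexp (R v)) * h v) := by
                  rw [← eexp_add, ← eexp_add, ← eexp_add]; congr 2; ring
              _ ≤ (eexp (-δ * (x - v)) * eexp (m + c₁)) *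
                    ((eexp s * step (fun x => W x * eexp (R x)) v) * h v) := by
                  exact mul_le_mul_right (mul_le_mul_left (Hs v).2 _) _
              _ = _ := by
                  rw [hψ, hk]
                  simp only
                  rw [eexp_add (m + c₁) s]
                  generalize eexp (m + c₁) = X
                  generalize eexp (-δ * (x - v)) = Y
                  ring
  · calc _ ≤ eexp c₂ * eLpNorm (fun x => W x * logJ r₀ q₀ b w h x) r volume := by
          refine eLpNorm_le_const_mul (eexp_ne_top _) (.of_forall fun x => ?_)
          rw [mul_left_comm (eexp c₂)]
          rw [hRw]
          exact mul_le_mul_right (H₂ h x hh) _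
      _ ≤ _ := mul_le_mul_left (eexp_mono (by linarith [abs_nonneg (k + s)])) _

/-- `logJ` of a constant. -/
lemma logJ_const_le {r₀ q₀ : ℝ≥0∞} {b w : ℝ → ℝ≥0∞} (hH : SVLog (logHead r₀ b))
    {κ c : ℝ} (hκ : 0 < κ) {R : ℝ → ℝ} (hR : LinGrowth κ c R)
    (hRw : ∀ x, eexp (R x) = w x * logHead r₀ b x) :
    ∃ d : ℝ, ∀ (k : ℝ≥0∞) (x : ℝ), logJ r₀ q₀ b w (fun _ => k) x ≤ eexp d * (eexp (R x) * k) := by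
  obtain ⟨c₁, hc₁, H₁⟩ := logJ_le_eexp_mul (q := q₀) hH hκ
  refine ⟨c₁ + c, fun k x => ?_⟩
  rw [eexp_add, mul_assoc]
  refine H₁ _ _ _ _ fun v hv => ?_
  rw [← hRw, ← mul_assoc, ← mul_assoc, ← eexp_add, ← eexp_add]
  refine mul_le_mul_left (eexp_mono ?_) _
  linarith [(hR v x hv.le).1]

/-! ### Passage to the logarithmic variable -/

lemma exp_image_preimage {S : Set ℝ} (hS : S ⊆ Ioi 0) : Real.exp '' (Real.exp ⁻¹' S) = S := by
  rw [image_preimage_eq_inter_range, Real.range_exp, inter_eq_left.2 hS]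

/-- Both `exp` and `log`, on `(0, ∞)`, are differentiable and so map null sets to null sets; no
measurability of `P` is needed. -/
lemma ae_restrict_exp_preimage_iff {S : Set ℝ} (hS : MeasurableSet S) (h0 : S ⊆ Ioi 0)
    {P : ℝ → Prop} : (∀ᵐ x ∂volume.restrict (Real.exp ⁻¹' S), P (Real.exp x)) ↔
      ∀ᵐ t ∂volume.restrict S, P t := by
  rw [ae_restrict_iff' hS, ae_restrict_iff' (Real.measurable_exp hS), ae_iff, ae_iff]
  set N := {t | ¬(t ∈ S → P t)} with hN
  have hN0 : N ⊆ Ioi 0 := fun t ht => h0 (Classical.not_imp.1 ht).1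
  change volume (Real.exp ⁻¹' N) = 0 ↔ volume N = 0
  constructor
  · intro h
    rw [← exp_image_preimage hN0]
    exact addHaar_image_eq_zero_of_differentiableOn_of_addHaar_eq_zero _
      Real.differentiable_exp.differentiableOn h
  · intro h
    refine measure_mono_null (t := Real.log '' N) (fun x hx => ⟨_, hx, Real.log_exp x⟩) ?_
    exact addHaar_image_eq_zero_of_differentiableOn_of_addHaar_eq_zero _
      (Real.differentiableOn_log.mono fun t ht => (hN0 ht).ne') h

lemma weight_exp (β : ℝ) (b : ℝ → ℝ) (x : ℝ) :
    weight β b (Real.exp x) = eexp (β * x) * ENNReal.ofReal (b (Real.exp x)) := by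
  rw [weight, ENNReal.ofReal_mul (by positivity), ← Real.exp_mul, mul_comm x]; rfl

/-- The passage to the logarithmic variable. -/
lemma lqNorm_weight_mul (q : ℝ≥0∞) {S : Set ℝ} (hS : MeasurableSet S) (h0 : S ⊆ Ioi 0)
    (α : ℝ) (b : ℝ → ℝ) (g : ℝ → ℝ≥0∞) :
    lqNorm q S (fun t => weight (α - recip q) b t * g t) =
      eLpNorm (fun x => eexp (α * x) * ENNReal.ofReal (b (Real.exp x)) * g (Real.exp x)) q
        (volume.restrict (Real.exp ⁻¹' S)) := by
  rw [lqNorm]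
  rcases eq_or_ne q 0 with rfl | hq0
  · simp
  rcases eq_or_ne q ∞ with rfl | hq
  · have hr : recip ∞ = 0 := by simp [recip]
    simp only [hr, sub_zero, eLpNorm_exponent_top]
    apply le_antisymm
    · refine eLpNormEssSup_le_of_ae_enorm_bound ?_
      simp only [enorm_eq_self]
      rw [← ae_restrict_exp_preimage_iff hS h0]
      have := ae_le_eLpNormEssSup (μ := volume.restrict (Real.exp ⁻¹' S))
        (f := fun x => eexp (α * x) * ENNReal.ofReal (b (Real.exp x)) * g (Real.exp x))
      filter_upwards [this] with x hx
      rw [weight_exp]; exact hx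
    · refine eLpNormEssSup_le_of_ae_enorm_bound ?_
      simp only [enorm_eq_self, ← weight_exp]
      rw [ae_restrict_exp_preimage_iff hS h0
        (P := fun t => weight α b t * g t ≤
          eLpNormEssSup (fun t => weight α b t * g t) (volume.restrict S))]
      exact ae_le_eLpNormEssSup (f := fun t => weight α b t * g t)
  · have hp := ENNReal.toReal_pos hq0 hq
    rw [eLpNorm_eq_lintegral_rpow_enorm_toReal hq0 hq,
      eLpNorm_eq_lintegral_rpow_enorm_toReal hq0 hq]
    congr 1
    conv_lhs => rw [← exp_image_preimage h0]
    rw [lintegral_image_eq_lintegral_abs_deriv_mul (Real.measurable_exp hS)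
      (fun x _ => (Real.hasDerivAt_exp x).hasDerivWithinAt) Real.exp_injective.injOn]
    refine lintegral_congr fun x => ?_
    rw [enorm_eq_self, enorm_eq_self, weight_exp, abs_of_pos (Real.exp_pos x)]
    -- The Jacobian `e^x` is exactly the `q`-th power of the factor `t^{1/q}` missing from the
    -- weight.
    have hr : recip q * q.toReal = 1 := by
      rw [recip, ENNReal.toReal_inv, inv_mul_cancel₀ hp.ne']
    have : α * x = (α - recip q) * x + recip q * x := by ring
    rw [this, eexp_add]
    rw [ENNReal.mul_rpow_of_nonneg _ _ hp.le, ENNReal.mul_rpow_of_nonneg _ _ hp.le,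
      ENNReal.mul_rpow_of_nonneg _ _ hp.le, ENNReal.mul_rpow_of_nonneg _ _ hp.le,
      ENNReal.mul_rpow_of_nonneg _ _ hp.le, eexp_rpow (recip q * x)]
    rw [show q.toReal * (recip q * x) = x by rw [← mul_assoc, mul_comm q.toReal, hr, one_mul]]
    change eexp x * _ = _
    ring

/-- A function on `(0, ∞)` in the logarithmic variable. -/
def logLift (b : ℝ → ℝ) (x : ℝ) : ℝ≥0∞ := ENNReal.ofReal (b (Real.exp x))

lemma EquivOn.trans_le {f g : ℝ → ℝ} {C s t : ℝ} (hC : 0 < C)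
    (h : ∀ t : ℝ, 0 < t → f t ≤ C * g t ∧ g t ≤ C * f t) (hs : 0 < s) (ht : 0 < t)
    (hst : g s ≤ g t) : f s ≤ C * C * f t := by
  calc f s ≤ C * g s := (h s hs).1
    _ ≤ C * (C * f t) := by gcongr; exact hst.trans (h t ht).2
    _ = _ := by ring

/-- The increasing equivalent bounds `b (exp x)` by `b (exp y)` when `x ≤ y`, the decreasing one
when `y ≤ x`; a common constant `D` serves both. -/
lemma SlowlyVarying.svLog {b : ℝ → ℝ} (hb : SlowlyVarying b) : SVLog (logLift b) := by
  have hpos : ∀ x, 0 < b (Real.exp x) := fun x => hb.pos _ (Real.exp_pos x)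
  refine ⟨fun x => by simpa [logLift] using hpos x, fun x => ENNReal.ofReal_ne_top,
    fun ε hε => ?_⟩
  obtain ⟨g, hg, C, hC, H⟩ := hb.equiv_increasing ε hε
  obtain ⟨g', hg', C', hC', H'⟩ := hb.equiv_decreasing ε hε
  set D := max 1 (max (C * C) (C' * C')) with hD
  have hD1 : 1 ≤ D := le_max_left _ _
  have hD0 : 0 < D := by linarith
  refine ⟨Real.log D, Real.log_nonneg hD1, fun x y => ?_⟩
  have key : b (Real.exp x) ≤ D * Real.exp (ε * |x - y|) * b (Real.exp y) := by
    rcases le_total x y with hxy | hxy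
    · have h1 := EquivOn.trans_le hC H (Real.exp_pos x) (Real.exp_pos y)
        (hg (Real.exp_pos x) (Real.exp_pos y) (Real.exp_le_exp.2 hxy))
      rw [← Real.exp_mul, ← Real.exp_mul] at h1
      have h2 : Real.exp (y * ε) = Real.exp (x * ε) * Real.exp (ε * |x - y|) := by
        rw [← Real.exp_add, abs_of_nonpos (sub_nonpos.2 hxy)]; congr 1; ring
      rw [h2] at h1
      refine le_of_mul_le_mul_left (h1.trans ?_) (Real.exp_pos (x * ε))
      calc C * C * (Real.exp (x * ε) * Real.exp (ε * |x - y|) * b (Real.exp y))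
          ≤ D * (Real.exp (x * ε) * Real.exp (ε * |x - y|) * b (Real.exp y)) := by
            have := hpos y
            refine mul_le_mul_of_nonneg_right ?_ (by positivity)
            exact (le_max_left _ _).trans (le_max_right _ _)
        _ = _ := by ring
    · have h1 := EquivOn.trans_le hC' H' (Real.exp_pos x) (Real.exp_pos y)
        (hg' (Real.exp_pos y) (Real.exp_pos x) (Real.exp_le_exp.2 hxy))
      rw [← Real.exp_mul, ← Real.exp_mul] at h1
      have h2 : Real.exp (y * -ε) = Real.exp (x * -ε) * Real.exp (ε * |x - y|) := by
        rw [← Real.exp_add, abs_of_nonneg (sub_nonneg.2 hxy)]; congr 1; ring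
      rw [h2] at h1
      refine le_of_mul_le_mul_left (h1.trans ?_) (Real.exp_pos (x * -ε))
      calc C' * C' * (Real.exp (x * -ε) * Real.exp (ε * |x - y|) * b (Real.exp y))
          ≤ D * (Real.exp (x * -ε) * Real.exp (ε * |x - y|) * b (Real.exp y)) := by
            have := hpos y
            refine mul_le_mul_of_nonneg_right ?_ (by positivity)
            exact (le_max_right _ _).trans (le_max_right _ _)
        _ = _ := by ring
  rw [logLift, logLift, eexp_add, eexp_log hD0, eexp, ← ENNReal.ofReal_mul hD0.le,
    ← ENNReal.ofReal_mul (by positivity)]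
  exact ENNReal.ofReal_le_ofReal key

lemma slowlyVarying_one : SlowlyVarying fun _ => 1 := by
  refine ⟨measurable_const.aemeasurable, fun _ _ => one_pos, fun ε hε => ?_, fun ε hε => ?_⟩
  · refine ⟨fun t => t ^ ε * 1, fun s hs t ht hst => ?_, 1, one_pos, fun t ht => by simp⟩
    simpa using Real.rpow_le_rpow (le_of_lt hs) hst hε.le
  · refine ⟨fun t => t ^ (-ε) * 1, fun s hs t ht hst => ?_, 1, one_pos, fun t ht => by simp⟩
    simpa using Real.rpow_le_rpow_of_nonpos hs hst (neg_nonpos.2 hε.le)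

lemma exp_preimage_Ioo_zero (x : ℝ) : Real.exp ⁻¹' (Ioo 0 (Real.exp x)) = Iio x := by
  ext u; simp [Real.exp_pos]

lemma exp_preimage_Ioo (u x : ℝ) : Real.exp ⁻¹' (Ioo (Real.exp u) (Real.exp x)) = Ioo u x := by
  ext v; simp

lemma exp_preimage_Ioi (u : ℝ) : Real.exp ⁻¹' (Ioi (Real.exp u)) = Ioi u := by
  ext v; simp

lemma exp_preimage_Ioi_zero : Real.exp ⁻¹' (Ioi 0) = univ := by
  ext v; simp [Real.exp_pos]

lemma lqNorm_head (r : ℝ≥0∞) (b : ℝ → ℝ) (x : ℝ) :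
    lqNorm r (Ioo 0 (Real.exp x)) (weight (-recip r) b) = logHead r (logLift b) x := by
  have := lqNorm_weight_mul r (S := Ioo 0 (Real.exp x)) measurableSet_Ioo (fun t ht => ht.1)
    0 b (fun _ => 1)
  simp only [zero_sub, mul_one, zero_mul, eexp_zero, one_mul, exp_preimage_Ioo_zero] at this
  exact this

/-- The log-log version of a function equivalent to a power times a slowly varying function grows
linearly. -/
lemma SVLog.linGrowth {g : ℝ → ℝ≥0∞} (hg : SVLog g) {α : ℝ} (hα : 0 < α) {R : ℝ → ℝ}
    (hR : ∀ x, eexp (R x) = eexp (α * x) * g x) : ∃ c : ℝ, 0 ≤ c ∧ LinGrowth (α / 2) c R := by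
  -- Allowing the slowly varying factor a rate `α / 2` puts the slopes of `R` between `α / 2` and
  -- `3α / 2`, whence the `κ` and `3 * κ` in `LinGrowth`.
  obtain ⟨c, hc, H⟩ := hg.bound (α / 2) (by positivity)
  have key : ∀ x y, R x - R y ≤ α * (x - y) + c + α / 2 * |x - y| := fun x y => by
    have : eexp (R x) ≤ eexp (α * (x - y) + (c + α / 2 * |x - y|) + R y) := by
      rw [eexp_add _ (R y), hR x, hR y, eexp_add]
      calc eexp (α * x) * g x ≤ eexp (α * x) * (eexp (c + α / 2 * |x - y|) * g y) := by
            gcongr; exact H x y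
        _ = (eexp (α * (x - y)) * eexp (α * y)) * (eexp (c + α / 2 * |x - y|) * g y) := by
            rw [← eexp_add]; congr 2; ring
        _ = _ := by
            generalize eexp (c + α / 2 * |x - y|) = X
            generalize eexp (α * (x - y)) = Y
            ring
    have := eexp_le_iff.1 this
    linarith
  refine ⟨c, hc, fun x y hxy => ?_⟩
  have h1 := key x y
  have h2 := key y x
  rw [abs_of_nonpos (sub_nonpos.2 hxy)] at h1
  rw [abs_of_nonneg (sub_nonneg.2 hxy)] at h2
  constructor <;> nlinarith

/-! ### Rearrangements and general facts on the `K`-functional -/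

section

variable {Ω : Type*} [MeasurableSpace Ω] {μ : Measure Ω} {𝕜 : Type*} [RCLike 𝕜]

lemma rearr_antitone (f : Ω →ₘ[μ] 𝕜) : Antitone (rearr f) := fun _ _ hst =>
  sInf_le_sInf fun _ hs => le_trans hs (ENNReal.ofReal_le_ofReal hst)

/-- The infimum defining the rearrangement is attained: the superlevel sets increase to this one as
the level decreases to `f*(t)`. -/
lemma measure_rearr_lt_le (f : Ω →ₘ[μ] 𝕜) (t : ℝ) :
    μ {x | rearr f t < ‖f x‖ₑ} ≤ ENNReal.ofReal t := by
  rcases eq_or_ne (rearr f t) ∞ with h | h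
  · rw [h]; simp
  obtain ⟨u, hu, hlt, hlim⟩ := exists_seq_strictAnti_tendsto' (lt_top_iff_ne_top.2 h)
  have hS : {x | rearr f t < ‖f x‖ₑ} = ⋃ n, {x | u n < ‖f x‖ₑ} := by
    ext x
    simp only [mem_iUnion]
    constructor
    · intro hx
      exact (hlim.eventually_lt_const hx).exists
    · rintro ⟨n, hn⟩
      exact (hlt n).1.trans hn
  have hmono : Monotone fun n => {x | u n < ‖f x‖ₑ} := fun m n hmn x hx =>
    (hu.antitone hmn).trans_lt hx
  rw [hS, hmono.measure_iUnion]
  refine iSup_le fun n => ?_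
  obtain ⟨s, hs, hsn⟩ := sInf_lt_iff.1 (hlt n).1
  exact (measure_mono fun x hx => hsn.trans hx).trans hs

lemma rearr_le_of_ae_le {f g : Ω →ₘ[μ] 𝕜} (h : ∀ᵐ x ∂μ, ‖f x‖ₑ ≤ ‖g x‖ₑ) (t : ℝ) :
    rearr f t ≤ rearr g t := by
  refine sInf_le_sInf fun s hs => le_trans (measure_mono_ae ?_) hs
  filter_upwards [h] with x hx hs using lt_of_lt_of_le hs hx

/-- Where `|f| ≤ f*(t)`, the sum is almost everywhere at most `f*(t) + ‖g‖_∞`. A bounded summand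
therefore costs no dilation of `t`. -/
lemma rearr_add_le (f g : Ω →ₘ[μ] 𝕜) (t : ℝ) :
    rearr (f + g) t ≤ rearr f t + eLpNorm g ∞ μ := by
  refine sInf_le (le_trans (measure_mono_ae ?_) (measure_rearr_lt_le f t))
  filter_upwards [AEEqFun.coeFn_add f g, ae_le_eLpNormEssSup (f := g) (μ := μ)] with x hx hg hlt
  have h1 : rearr f t + eLpNorm g ∞ μ < ‖(f + g) x‖ₑ := hlt
  rw [hx, Pi.add_apply] at h1
  rw [← eLpNorm_exponent_top] at hg
  change rearr f t < ‖f x‖ₑ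
  by_contra hcon
  refine absurd h1 (not_lt.2 ?_)
  exact (enorm_add_le _ _).trans (add_le_add (not_lt.1 hcon) hg)

/-- A function splits at the level `f^*(t)` into a function supported on a set of measure at most
`t` and a bounded one. -/
lemma exists_level_decomposition (f : Ω →ₘ[μ] 𝕜) (t : ℝ) :
    ∃ f₀ f₁ : Ω →ₘ[μ] 𝕜, f = f₀ + f₁ ∧ (∀ s, rearr f₀ s ≤ rearr f s) ∧
      (∀ s, t ≤ s → rearr f₀ s = 0) ∧ eLpNorm f₁ ∞ μ ≤ rearr f t := by
  set S := {x | rearr f t < ‖f x‖ₑ} with hSdef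
  have hS : MeasurableSet S := measurableSet_lt measurable_const f.measurable.enorm
  have m0 : AEStronglyMeasurable (S.indicator f) μ := f.aestronglyMeasurable.indicator hS
  have m1 : AEStronglyMeasurable (Sᶜ.indicator f) μ := f.aestronglyMeasurable.indicator hS.compl
  have e0 := AEEqFun.coeFn_mk (S.indicator f) m0
  have e1 := AEEqFun.coeFn_mk (Sᶜ.indicator f) m1
  refine ⟨AEEqFun.mk _ m0, AEEqFun.mk _ m1, ?_, fun s => ?_, fun s hs => ?_, ?_⟩
  · refine AEEqFun.ext ?_
    filter_upwards [AEEqFun.coeFn_add (AEEqFun.mk _ m0) (AEEqFun.mk _ m1), e0, e1] with x h h0 h1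
    rw [h, Pi.add_apply, h0, h1, indicator_self_add_compl_apply]
  · refine rearr_le_of_ae_le ?_ s
    filter_upwards [e0] with x h0
    rw [h0]
    exact enorm_indicator_le_enorm_self _ _
  · refine le_antisymm (sInf_le ?_) zero_le
    refine le_trans (measure_mono_ae ?_)
      ((measure_rearr_lt_le f t).trans (ENNReal.ofReal_le_ofReal hs))
    filter_upwards [e0] with x h0 hx
    have hx' : 0 < ‖(AEEqFun.mk _ m0 : Ω →ₘ[μ] 𝕜) x‖ₑ := hx
    rw [h0] at hx'
    by_contra hcon
    have hxS : x ∉ S := hcon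
    rw [indicator_of_notMem hxS] at hx'
    simp at hx'
  · rw [eLpNorm_exponent_top]
    refine eLpNormEssSup_le_of_ae_enorm_bound ?_
    filter_upwards [e1] with x h1
    rw [h1]
    by_cases hx : x ∈ S
    · rw [indicator_of_notMem (notMem_compl_iff.2 hx)]; simp
    · rw [indicator_of_mem (mem_compl hx)]; exact not_lt.1 hx

lemma eLpNorm_le_restrict_of_eq_zero {q : ℝ≥0∞} {ν : Measure ℝ} {s : Set ℝ} (hs : MeasurableSet s)
    {g : ℝ → ℝ≥0∞} (hg : ∀ x ∉ s, g x = 0) : eLpNorm g q ν ≤ eLpNorm g q (ν.restrict s) := by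
  rw [← eLpNorm_indicator_eq_eLpNorm_restrict hs]
  refine eLpNorm_mono_of_ae_le (.of_forall fun x => ?_)
  by_cases hx : x ∈ s
  · rw [indicator_of_mem hx]
  · rw [hg x hx]; exact zero_le

/-- The iterated norm `‖b(u) ‖w h‖_{q,(u,∞)}‖_{r,(-∞,∞)}`. -/
def logN (r q : ℝ≥0∞) (b w h : ℝ → ℝ≥0∞) : ℝ≥0∞ :=
  eLpNorm (fun u => b u * eLpNorm (fun v => w v * h v) q (volume.restrict (Ioi u))) r volume

variable {r q : ℝ≥0∞} {b w : ℝ → ℝ≥0∞}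

lemma logJ_le_logN (h : ℝ → ℝ≥0∞) (x : ℝ) : logJ r q b w h x ≤ logN r q b w h := by
  refine (eLpNorm_mono_of_ae_le (.of_forall fun u => ?_)).trans
    (eLpNorm_mono_measure _ Measure.restrict_le_self)
  gcongr
  exact Ioo_subset_Ioi_self

/-- Vanishing of `h'` beyond `x` cuts both the inner and the outer domain at `x`. It serves for the
large part of `f` in the level decomposition. -/
lemma logN_le_logJ {h h' : ℝ → ℝ≥0∞} {x : ℝ} (hle : ∀ v, h' v ≤ h v)
    (h0 : ∀ v, x ≤ v → h' v = 0) : logN r q b w h' ≤ logJ r q b w h x := by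
  refine le_trans ?_ (logJ_mono hle)
  have inner : ∀ u, eLpNorm (fun v => w v * h' v) q (volume.restrict (Ioi u)) ≤
      eLpNorm (fun v => w v * h' v) q (volume.restrict (Ioo u x)) := fun u => by
    refine (eLpNorm_le_restrict_of_eq_zero (s := Iio x) measurableSet_Iio fun v hv => ?_).trans
      (le_of_eq ?_)
    · rw [h0 v (not_lt.1 hv), mul_zero]
    · rw [Measure.restrict_restrict measurableSet_Iio, inter_comm]; rfl
  refine (eLpNorm_mono_of_ae_le (.of_forall fun u => mul_le_mul_right (inner u) _)).trans ?_
  refine eLpNorm_le_restrict_of_eq_zero measurableSet_Iio fun u hu => ?_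
  rw [Ioo_eq_empty (by simpa using hu)]
  simp

lemma Kfun_le {A₀ A₁ : FunSpace μ 𝕜} {t : ℝ} {f f₀ f₁ : Ω →ₘ[μ] 𝕜} (h₀ : f₀ ∈ A₀.carrier)
    (h₁ : f₁ ∈ A₁.carrier) (h : f = f₀ + f₁) :
    Kfun A₀ A₁ t f ≤ A₀.qnorm f₀ + ENNReal.ofReal t * A₁.qnorm f₁ :=
  iInf_le_of_le f₀ <| iInf_le_of_le h₀ <| iInf_le_of_le f₁ <| iInf_le_of_le h₁ <|
    iInf_le_of_le h le_rfl

lemma le_Kfun {A₀ A₁ : FunSpace μ 𝕜} {t : ℝ} {f : Ω →ₘ[μ] 𝕜} {k : ℝ≥0∞}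
    (h : ∀ f₀ ∈ A₀.carrier, ∀ f₁ ∈ A₁.carrier, f = f₀ + f₁ →
      k ≤ A₀.qnorm f₀ + ENNReal.ofReal t * A₁.qnorm f₁) : k ≤ Kfun A₀ A₁ t f :=
  le_iInf fun f₀ => le_iInf fun h₀ => le_iInf fun f₁ => le_iInf fun h₁ => le_iInf fun he =>
    h f₀ h₀ f₁ h₁ he

/-- This exponential regularity of `K` is what admits the substitution of linear growth in the
interpolation norm. -/
lemma Kfun_exp_le (A₀ A₁ : FunSpace μ 𝕜) (f : Ω →ₘ[μ] 𝕜) (x y : ℝ) :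
    Kfun A₀ A₁ (Real.exp x) f ≤ eexp |x - y| * Kfun A₀ A₁ (Real.exp y) f := by
  refine le_eexp_mul_of_eexp_neg_mul_le (le_Kfun fun f₀ h₀ f₁ h₁ he => ?_)
  have hxy : eexp x ≤ eexp |x - y| * eexp y := by
    rw [← eexp_add]; exact eexp_mono (by linarith [le_abs_self (x - y)])
  calc _ ≤ eexp (- |x - y|) * (A₀.qnorm f₀ + eexp x * A₁.qnorm f₁) := by
        gcongr; exact Kfun_le h₀ h₁ he
    _ ≤ eexp (- |x - y|) * (eexp |x - y| * A₀.qnorm f₀ + eexp |x - y| * eexp y * A₁.qnorm f₁) := by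
        gcongr
        exact le_mul_of_one_le_left' (one_le_eexp (abs_nonneg _))
    _ = (eexp |x - y| * eexp (- |x - y|)) * (A₀.qnorm f₀ + eexp y * A₁.qnorm f₁) := by ring
    _ = _ := by rw [eexp_mul_eexp_neg, one_mul]; rfl

/-- Without a decomposition `K` is an infimum over the empty set, hence `∞`, and the positive weight
makes the norm infinite. -/
lemma exists_decomposition_of_interpNorm_lt_top {A₀ A₁ : FunSpace μ 𝕜} {θ : ℝ} {q : ℝ≥0∞}
    (hq : q ≠ 0) {a : ℝ → ℝ} (ha : ∀ t, 0 < t → 0 < a t) {f : Ω →ₘ[μ] 𝕜}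
    (h : interpNorm A₀ A₁ θ q a f < ∞) : ∃ f₀ ∈ A₀.carrier, ∃ f₁ ∈ A₁.carrier, f = f₀ + f₁ := by
  by_contra hcon
  refine h.ne (top_le_iff.1 ?_)
  refine le_eLpNorm_of_ae_le hq (by simp) ?_
  filter_upwards [ae_restrict_mem measurableSet_Ioi] with t ht
  have hK : Kfun A₀ A₁ t f = ∞ := top_le_iff.1 <|
    le_Kfun fun f₀ h₀ f₁ h₁ he => (hcon ⟨f₀, h₀, f₁, h₁, he⟩).elim
  have ht' : 0 < t := ht
  have hw : weight (-θ - recip q) a t ≠ 0 := by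
    rw [weight, Ne, ENNReal.ofReal_eq_zero, not_le]
    exact mul_pos (Real.rpow_pos_of_pos ht' _) (ha t ht')
  rw [hK, ENNReal.mul_top hw]

lemma FunSpace.embeds_of_le {X Y : FunSpace μ 𝕜} {d : ℝ} (h : X.carrier ⊆ Y.carrier)
    (hd : ∀ f, Y.qnorm f ≤ eexp d * X.qnorm f) : X.Embeds Y :=
  ⟨h, (eexp d).toNNReal, fun f _ => by rw [ENNReal.coe_toNNReal (eexp_ne_top d)]; exact hd f⟩

lemma interp_same_of_equiv {A₀ A₁ : FunSpace μ 𝕜} {θ : ℝ} {q : ℝ≥0∞}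
    (hq : q ≠ 0) {a : ℝ → ℝ} (ha : ∀ t, 0 < t → 0 < a t) {N : (Ω →ₘ[μ] 𝕜) → ℝ≥0∞} {d : ℝ}
    (h : ∀ f, N f ≤ eexp d * interpNorm A₀ A₁ θ q a f ∧
      interpNorm A₀ A₁ θ q a f ≤ eexp d * N f) :
    (interp A₀ A₁ θ q a).Same (FunSpace.ofNorm N) := by
  refine ⟨FunSpace.embeds_of_le (fun f hf => ?_) fun f => (h f).1,
    FunSpace.embeds_of_le (fun f hf => ?_) fun f => (h f).2⟩
  · exact (h f).1.trans_lt (ENNReal.mul_lt_top (eexp_ne_top d).lt_top hf.2)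
  · have : interpNorm A₀ A₁ θ q a f < ∞ :=
      (h f).2.trans_lt (ENNReal.mul_lt_top (eexp_ne_top d).lt_top hf)
    exact ⟨exists_decomposition_of_interpNorm_lt_top hq ha this, this⟩

end

/-! ### The couple of an `𝓡` space and `L_∞` -/

section

variable {Ω : Type*} [MeasurableSpace Ω] {μ : Measure Ω} {𝕜 : Type*} [RCLike 𝕜]

/-- The rearrangement in the logarithmic variable. -/
def logRearr (f : Ω →ₘ[μ] 𝕜) (v : ℝ) : ℝ≥0∞ := rearr f (Real.exp v)

lemma logRearr_antitone (f : Ω →ₘ[μ] 𝕜) : Antitone (logRearr f) :=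
  (rearr_antitone f).comp_monotone Real.exp_monotone

/-- The power weight `t ^ α * a t` in the logarithmic variable. -/
def logWeight (α : ℝ) (a : ℝ → ℝ) (v : ℝ) : ℝ≥0∞ := eexp (α * v) * logLift a v

lemma LR_eq (p r : ℝ≥0∞) (b : ℝ → ℝ) (q : ℝ≥0∞) (a : ℝ → ℝ) :
    LR μ 𝕜 p r b q a = .ofNorm fun f =>
      logN r q (logLift b) (logWeight (recip p) a) (logRearr f) := by
  rw [LR]
  congr 1
  funext f
  rw [← zero_sub, lqNorm_weight_mul r measurableSet_Ioi subset_rfl, exp_preimage_Ioi_zero,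
    Measure.restrict_univ, logN]
  congr 1
  funext u
  rw [zero_mul, eexp_zero, one_mul, lqNorm_weight_mul q measurableSet_Ioi
    (Ioi_subset_Ioi (Real.exp_pos u).le), exp_preimage_Ioi]
  rfl

lemma LRL_eq (p s : ℝ≥0∞) (c : ℝ → ℝ) (r : ℝ≥0∞) (b : ℝ → ℝ) (q : ℝ≥0∞) (a : ℝ → ℝ) :
    LRL μ 𝕜 p s c r b q a = .ofNorm fun f =>
      eLpNorm (fun x => logLift c x *
        logJ r q (logLift b) (logWeight (recip p) a) (logRearr f) x) s volume := by
  rw [LRL]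
  congr 1
  funext f
  rw [← zero_sub, lqNorm_weight_mul s measurableSet_Ioi subset_rfl, exp_preimage_Ioi_zero,
    Measure.restrict_univ]
  congr 1
  funext x
  rw [zero_mul, eexp_zero, one_mul, ← zero_sub, lqNorm_weight_mul r measurableSet_Ioo
    (fun t ht => ht.1), exp_preimage_Ioo_zero, logJ, logLift]
  congr 2
  funext u
  rw [zero_mul, eexp_zero, one_mul, lqNorm_weight_mul q measurableSet_Ioo
    (fun t ht => (Real.exp_pos u).trans ht.1), exp_preimage_Ioo]
  rfl

lemma LK_eq (p q : ℝ≥0∞) (a : ℝ → ℝ) :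
    LK μ 𝕜 p q a = .ofNorm fun f =>
      eLpNorm (fun x => logWeight (recip p) a x * logRearr f x) q volume := by
  rw [LK]
  congr 1
  funext f
  rw [lqNorm_weight_mul q measurableSet_Ioi subset_rfl, exp_preimage_Ioi_zero,
    Measure.restrict_univ]
  rfl

lemma interpNorm_eq (A₀ A₁ : FunSpace μ 𝕜) (θ : ℝ) (q : ℝ≥0∞) (a : ℝ → ℝ) (f : Ω →ₘ[μ] 𝕜) :
    interpNorm A₀ A₁ θ q a f =
      eLpNorm (fun x => logWeight (-θ) a x * Kfun A₀ A₁ (Real.exp x) f) q volume := by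
  rw [interpNorm, lqNorm_weight_mul q measurableSet_Ioi subset_rfl, exp_preimage_Ioi_zero,
    Measure.restrict_univ]
  rfl

lemma grandLK_eq (p q r : ℝ≥0∞) (b : ℝ → ℝ) :
    grandLK μ 𝕜 p q r b = LR μ 𝕜 p r b q fun _ => 1 := by
  simp only [grandLK, LR, weight, mul_one]

section Couple

variable {r₀ q₀ : ℝ≥0∞} {b w : ℝ → ℝ≥0∞}

/-- The `K`-functional of the couple formed by an `𝓡` space and `L_∞`. -/
lemma Kfun_equiv (hr₀ : r₀ ≠ 0) (hq₀ : q₀ ≠ 0) (hb : SVLog b) (hH : SVLog (logHead r₀ b))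
    (hw : Reg w) {κ c : ℝ} (hκ : 0 < κ) {R : ℝ → ℝ} (hR : LinGrowth κ c R)
    (hRw : ∀ x, eexp (R x) = w x * logHead r₀ b x) :
    ∃ d : ℝ, 0 ≤ d ∧ ∀ (f : Ω →ₘ[μ] 𝕜) (x : ℝ),
      Kfun (.ofNorm fun f => logN r₀ q₀ b w (logRearr f)) (Linf μ 𝕜) (Real.exp (R x)) f ≤
        eexp d * logJ r₀ q₀ b w (logRearr f) x ∧
      logJ r₀ q₀ b w (logRearr f) x ≤ eexp d *
        Kfun (.ofNorm fun f => logN r₀ q₀ b w (logRearr f)) (Linf μ 𝕜) (Real.exp (R x)) f := by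
  obtain ⟨c₁, hc₁, H₁⟩ := le_eexp_mul_logJ hr₀ hq₀ hb.ne_zero hH.reg hw
  obtain ⟨c₂, H₂⟩ := logJ_const_le (q₀ := q₀) hH hκ hR hRw
  obtain ⟨c₃, hc₃, H₃⟩ := logJ_add_le hb.reg hw r₀ q₀
  obtain ⟨d₁, hd₁, hd₁'⟩ := exists_le_eexp
    (ENNReal.add_ne_top.2 ⟨ENNReal.one_ne_top, eexp_ne_top c₁⟩)
  refine ⟨d₁ + (c₃ + |c₂|), by positivity, fun f x => ⟨?_, ?_⟩⟩
  · rcases eq_or_ne (logJ r₀ q₀ b w (logRearr f) x) ∞ with hJ | hJ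
    · rw [hJ, ENNReal.mul_top (eexp_ne_zero _)]; exact le_top
    have hx := H₁ (logRearr f) x (logRearr_antitone f)
    rw [← hRw] at hx
    obtain ⟨f₀, f₁, hf, hle, h0, h1⟩ := exists_level_decomposition f (Real.exp x)
    have hN : logN r₀ q₀ b w (logRearr f₀) ≤ logJ r₀ q₀ b w (logRearr f) x :=
      logN_le_logJ (fun v => hle _) fun v hv => h0 _ (Real.exp_le_exp.2 hv)
    -- Finiteness of the cutting level is what places the small part `f₁` in `L_∞`.
    have hfx : logRearr f x ≠ ∞ := by
      intro htop
      rw [htop, ENNReal.mul_top (eexp_ne_zero _), top_le_iff] at hx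
      exact ENNReal.mul_ne_top (eexp_ne_top _) hJ hx
    have hK := Kfun_le (A₀ := .ofNorm fun f => logN r₀ q₀ b w (logRearr f)) (A₁ := Linf μ 𝕜)
      (t := Real.exp (R x)) (show logN r₀ q₀ b w (logRearr f₀) < ∞ from hN.trans_lt hJ.lt_top)
      (show eLpNorm f₁ ∞ μ < ∞ from h1.trans_lt hfx.lt_top) hf
    calc _ ≤ logN r₀ q₀ b w (logRearr f₀) + eexp (R x) * eLpNorm f₁ ∞ μ := hK
      _ ≤ logJ r₀ q₀ b w (logRearr f) x + eexp c₁ * logJ r₀ q₀ b w (logRearr f) x := by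
          refine add_le_add hN (le_trans ?_ hx)
          gcongr
          exact h1
      _ = (1 + eexp c₁) * logJ r₀ q₀ b w (logRearr f) x := by ring
      _ ≤ _ := mul_le_mul_left (hd₁'.trans (eexp_mono (by linarith [abs_nonneg c₂]))) _
  · refine le_eexp_mul_of_eexp_neg_mul_le (le_Kfun fun f₀ h₀ f₁ h₁ he => ?_)
    have key : logJ r₀ q₀ b w (logRearr f) x ≤ eexp (c₃ + |c₂|) *
        (logN r₀ q₀ b w (logRearr f₀) + eexp (R x) * eLpNorm f₁ ∞ μ) := by
      calc logJ r₀ q₀ b w (logRearr f) x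
          ≤ logJ r₀ q₀ b w (fun v => logRearr f₀ v + eLpNorm f₁ ∞ μ) x :=
            logJ_mono fun v => by rw [he]; exact rearr_add_le f₀ f₁ _
        _ ≤ eexp c₃ * (logJ r₀ q₀ b w (logRearr f₀) x +
              logJ r₀ q₀ b w (fun _ => eLpNorm f₁ ∞ μ) x) :=
            H₃ _ _ _ (logRearr_antitone f₀).measurable measurable_const
        _ ≤ eexp c₃ * (eexp |c₂| * logN r₀ q₀ b w (logRearr f₀) +
              eexp |c₂| * (eexp (R x) * eLpNorm f₁ ∞ μ)) := by
            gcongr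
            · exact (logJ_le_logN _ _).trans
                (le_mul_of_one_le_left' (one_le_eexp (abs_nonneg _)))
            · exact (H₂ _ x).trans (mul_le_mul_left (eexp_mono (le_abs_self _)) _)
        _ = _ := by rw [eexp_add, ← mul_add, mul_assoc]
    calc _ ≤ eexp (-(d₁ + (c₃ + |c₂|))) * (eexp (d₁ + (c₃ + |c₂|)) *
          (logN r₀ q₀ b w (logRearr f₀) + eexp (R x) * eLpNorm f₁ ∞ μ)) := by
          gcongr
          exact key.trans (mul_le_mul_left (eexp_mono (by linarith)) _)
      _ = _ := by
          rw [← mul_assoc, mul_comm (eexp (-_)), eexp_mul_eexp_neg, one_mul]; rfl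

/-- The interpolation norm of the couple formed by an `𝓡` space and `L_∞`. -/
lemma interpNorm_equiv (hr₀ : r₀ ≠ 0) (hq₀ : q₀ ≠ 0) (hb : SVLog b)
    (hH : SVLog (logHead r₀ b)) (hw : Reg w) {κ c : ℝ} (hκ : 0 < κ) (hc : 0 ≤ c) {R : ℝ → ℝ}
    (hR : LinGrowth κ c R) (hRw : ∀ x, eexp (R x) = w x * logHead r₀ b x) {a : ℝ → ℝ}
    (ha : SVLog (logLift a)) (θ : ℝ) (r : ℝ≥0∞) :
    ∃ d : ℝ, 0 ≤ d ∧ ∀ f : Ω →ₘ[μ] 𝕜,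
      eLpNorm (fun x => logWeight (-θ) a (R x) * logJ r₀ q₀ b w (logRearr f) x) r volume ≤
        eexp d * interpNorm (.ofNorm fun f => logN r₀ q₀ b w (logRearr f)) (Linf μ 𝕜) θ r a f ∧
      interpNorm (.ofNorm fun f => logN r₀ q₀ b w (logRearr f)) (Linf μ 𝕜) θ r a f ≤
        eexp d *
          eLpNorm (fun x => logWeight (-θ) a (R x) * logJ r₀ q₀ b w (logRearr f) x) r volume := by
  obtain ⟨d₁, hd₁, H₁⟩ := Kfun_equiv (μ := μ) (𝕜 := 𝕜) hr₀ hq₀ hb hH hw hκ hR hRw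
  obtain ⟨C, E, hC, hE, HE⟩ := ha.reg_eexp_mul (-θ)
  -- The exponent `E` comes from the weight, the extra `1` from the `K`-functional.
  obtain ⟨d₂, hd₂, H₂⟩ := hR.eLpNorm_comp_equiv hκ hc r C (E + 1) hC (by positivity)
  refine ⟨d₁ + d₂, by positivity, fun f => ?_⟩
  set K : ℝ → ℝ≥0∞ := fun y =>
    Kfun (.ofNorm fun f => logN r₀ q₀ b w (logRearr f)) (Linf μ 𝕜) (Real.exp y) f with hK
  obtain ⟨h1, h2⟩ := H₂ (fun y => logWeight (-θ) a y * K y) fun x y => by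
    calc _ ≤ (eexp (C + E * |x - y|) * logWeight (-θ) a y) * (eexp |x - y| * K y) :=
          mul_le_mul' (HE x y) (Kfun_exp_le _ _ f x y)
      _ = _ := by rw [mul_mul_mul_comm, ← eexp_add]; congr 2; ring
  rw [interpNorm_eq]
  constructor
  · calc _ ≤ eexp d₁ * eLpNorm (fun x => logWeight (-θ) a (R x) * K (R x)) r volume := by
          refine eLpNorm_le_const_mul (eexp_ne_top _) (.of_forall fun x => ?_)
          rw [mul_left_comm (eexp d₁)]
          exact mul_le_mul_right (H₁ f x).2 _
      _ ≤ _ := by rw [eexp_add, mul_assoc]; exact mul_le_mul_right h1 _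
  · calc _ ≤ eexp d₂ * eLpNorm (fun x => logWeight (-θ) a (R x) * K (R x)) r volume := h2
      _ ≤ _ := by
          rw [add_comm, eexp_add, mul_assoc]
          refine mul_le_mul_right (eLpNorm_le_const_mul (eexp_ne_top _) (.of_forall fun x => ?_)) _
          rw [mul_left_comm (eexp d₁)]
          exact mul_le_mul_right (H₁ f x).1 _

end Couple

/-- The second conclusion has no upper limit on `θ`: the collapse needs only `θ > 0`, and stating
the relation through `recip` lets `θ = 1`, `p = ∞` fall under it. -/
lemma interp_LR_Linf_same (μ : Measure Ω) (𝕜 : Type*) [RCLike 𝕜] {p₀ r r₀ q₀ : ℝ≥0∞}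
    (hp₀ : 0 < p₀) (hp₀' : p₀ < ∞) (hr : 0 < r) (hr₀ : 0 < r₀) (hq₀ : 0 < q₀) {a a₀ b₀ : ℝ → ℝ}
    (ha : SlowlyVarying a) (ha₀ : SlowlyVarying a₀) (hb₀ : SlowlyVarying b₀)
    (hb₀' : lqNorm r₀ (Ioo 0 1) (weight (-recip r₀) b₀) < ∞) {χ ρ : ℝ → ℝ}
    (hχ : χ = chi r₀ b₀ a₀) (hρ : ρ = rho p₀ χ) :
    (interp (LR μ 𝕜 p₀ r₀ b₀ q₀ a₀) (Linf μ 𝕜) 0 r a).Same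
      (LRL μ 𝕜 p₀ r (a ∘ ρ) r₀ b₀ q₀ a₀) ∧
    ∀ (θ : ℝ) (p : ℝ≥0∞), 0 < θ → recip p = (1 - θ) * recip p₀ →
      (interp (LR μ 𝕜 p₀ r₀ b₀ q₀ a₀) (Linf μ 𝕜) θ r a).Same
        (LK μ 𝕜 p r (fun t => χ t ^ (1 - θ) * a (ρ t))) := by
  have hb := hb₀.svLog
  have hA := ha.svLog
  have hH : SVLog (logHead r₀ (logLift b₀)) := hb.logHead hr₀.ne' (by
    rw [← lqNorm_head, Real.exp_zero]; exact hb₀'.ne)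
  have hα : 0 < recip p₀ := ENNReal.toReal_pos (ENNReal.inv_ne_zero.2 hp₀'.ne)
    (ENNReal.inv_ne_top.2 hp₀.ne')
  have hχx : ∀ x, ENNReal.ofReal (χ (Real.exp x)) =
      logLift a₀ x * logHead r₀ (logLift b₀) x := fun x => by
    rw [hχ, chi, headNorm, lqNorm_head, ENNReal.ofReal_mul (ha₀.pos _ (Real.exp_pos x)).le,
      ENNReal.ofReal_toReal (hH.ne_top x)]
    rfl
  have hχ0 : ∀ x, 0 < χ (Real.exp x) := fun x => by
    rw [← ENNReal.ofReal_pos, hχx]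
    exact pos_iff_ne_zero.2 (mul_ne_zero (ha₀.svLog.ne_zero x) (hH.ne_zero x))
  have hρ' : ∀ x, ρ (Real.exp x) = Real.exp (recip p₀ * x) * χ (Real.exp x) := fun x => by
    rw [hρ, rho, ← Real.exp_mul, mul_comm x]
  have hρ0 : ∀ x, 0 < ρ (Real.exp x) := fun x => by
    rw [hρ']; exact mul_pos (Real.exp_pos _) (hχ0 x)
  -- The function `ρ` read in logarithmic coordinates on both sides.
  set R : ℝ → ℝ := fun x => Real.log (ρ (Real.exp x)) with hRdef
  have hexpR : ∀ x, Real.exp (R x) = ρ (Real.exp x) := fun x => Real.exp_log (hρ0 x)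
  have hRg : ∀ x, eexp (R x) = eexp (recip p₀ * x) *
      (logLift a₀ x * logHead r₀ (logLift b₀) x) := fun x => by
    rw [eexp, hexpR, hρ', ENNReal.ofReal_mul (Real.exp_pos _).le, hχx]; rfl
  have hRw : ∀ x, eexp (R x) = logWeight (recip p₀) a₀ x * logHead r₀ (logLift b₀) x := fun x => by
    rw [hRg, logWeight, mul_assoc]
  obtain ⟨c, hc, hR⟩ := (ha₀.svLog.mul hH).linGrowth hα hRg
  have hκ : 0 < recip p₀ / 2 := by positivity
  have hw : Reg (logWeight (recip p₀) a₀) := ha₀.svLog.reg_eexp_mul _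
  rw [LR_eq]
  constructor
  · obtain ⟨d, hd, H⟩ := interpNorm_equiv (μ := μ) (𝕜 := 𝕜) hr₀.ne' hq₀.ne' hb hH hw hκ hc hR hRw
      hA 0 r
    rw [LRL_eq]
    refine interp_same_of_equiv (d := d) hr.ne' ha.pos fun f => ?_
    have hW : ∀ x, logWeight (-0) a (R x) = logLift (a ∘ ρ) x := fun x => by
      rw [logWeight, neg_zero, zero_mul, eexp_zero, one_mul, logLift, hexpR]; rfl
    simpa only [hW] using H f
  · intro θ p hθ hp
    obtain ⟨d, hd, H⟩ := interpNorm_equiv (μ := μ) (𝕜 := 𝕜) hr₀.ne' hq₀.ne' hb hH hw hκ hc hR hRw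
      hA θ r
    obtain ⟨e, he, H'⟩ := eLpNorm_weight_logJ_equiv hr₀.ne' hq₀.ne' hr.ne' hb hH hw hA hκ hc hR
      hRw hθ
    rw [LK_eq]
    refine interp_same_of_equiv (d := d + e) hr.ne' ha.pos fun f => ?_
    have hW : ∀ x, logWeight (recip p) (fun t => χ t ^ (1 - θ) * a (ρ t)) x * logRearr f x =
        eexp (-θ * R x) * logLift a (R x) * (eexp (R x) * logRearr f x) := fun x => by
      -- This is `ρ^{1-θ} = t^{1/p} χ^{1-θ}`, the source of the weight `a^#`.
      have h1 : eexp (-θ * R x) * eexp (R x) =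
          eexp (recip p * x) * ENNReal.ofReal (χ (Real.exp x) ^ (1 - θ)) := by
        have hRx : R x = recip p₀ * x + Real.log (χ (Real.exp x)) := by
          rw [hRdef]
          simp only
          rw [hρ', Real.log_mul (Real.exp_pos _).ne' (hχ0 x).ne', Real.log_exp]
        have h2 : ENNReal.ofReal (χ (Real.exp x) ^ (1 - θ)) =
            eexp (Real.log (χ (Real.exp x)) * (1 - θ)) := by
          rw [Real.rpow_def_of_pos (hχ0 x)]; rfl
        rw [h2, ← eexp_add, ← eexp_add, hp, hRx]
        congr 1; ring
      rw [logWeight, logLift, ENNReal.ofReal_mul (Real.rpow_nonneg (hχ0 x).le _), ← mul_assoc,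
        ← h1, logLift, hexpR]
      ring
    simp only [hW]
    obtain ⟨h1, h2⟩ := H f
    obtain ⟨h3, h4⟩ := H' (logRearr f) (logRearr_antitone f)
    constructor
    · refine h4.trans ?_
      rw [add_comm, eexp_add, mul_assoc]
      exact mul_le_mul_right h1 _
    · refine h2.trans ?_
      rw [eexp_add, mul_assoc]
      exact mul_le_mul_right h3 _

lemma recip_eq_of_inv_eq {p p₀ : ℝ≥0∞} {θ : ℝ} (hθ : θ < 1)
    (h : p⁻¹ = ENNReal.ofReal (1 - θ) / p₀) : recip p = (1 - θ) * recip p₀ := by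
  rw [recip, recip, h, div_eq_mul_inv, ENNReal.toReal_mul, ENNReal.toReal_ofReal (by linarith)]

lemma recip_top : recip ∞ = 0 := by simp [recip]

lemma chi_one (r : ℝ≥0∞) (b : ℝ → ℝ) : chi r b (fun _ => 1) = headNorm r b := by
  funext t; rw [chi, one_mul]

end

end LorentzKaramata

end

open LorentzKaramata in
theorem corollary7p1 {Ω : Type*} [MeasurableSpace Ω] (μ : Measure Ω) [SigmaFinite μ]
    (hμ : NonAtomic μ) (𝕜 : Type*) [RCLike 𝕜]
    (p₀ r r₀ q₀ : ℝ≥0∞) (hp₀ : 0 < p₀) (hp₀' : p₀ < ∞) (hr : 0 < r) (hr₀ : 0 < r₀) (hq₀ : 0 < q₀)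
    (a a₀ b₀ : ℝ → ℝ) (ha : SlowlyVarying a) (ha₀ : SlowlyVarying a₀) (hb₀ : SlowlyVarying b₀)
    (hb₀' : lqNorm r₀ (Ioo 0 1) (weight (-recip r₀) b₀) < ∞) :
    -- the couple `(L^𝓡_{p₀,r₀,b₀,q₀,a₀}, L_∞)`
    (∀ χ ρ : ℝ → ℝ, χ = chi r₀ b₀ a₀ → ρ = rho p₀ χ →
      (lqNorm r (Ioi 1) (weight (-recip r) a) < ∞ →
        (interp (LR μ 𝕜 p₀ r₀ b₀ q₀ a₀) (Linf μ 𝕜) 0 r a).Same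
          (LRL μ 𝕜 p₀ r (a ∘ ρ) r₀ b₀ q₀ a₀)) ∧
      (∀ (θ : ℝ) (p : ℝ≥0∞), 0 < θ → θ < 1 → p⁻¹ = ENNReal.ofReal (1 - θ) / p₀ →
        (interp (LR μ 𝕜 p₀ r₀ b₀ q₀ a₀) (Linf μ 𝕜) θ r a).Same
          (LK μ 𝕜 p r (fun t => χ t ^ (1 - θ) * a (ρ t)))) ∧
      (lqNorm r (Ioo 0 1) (weight (-recip r) a) < ∞ →
        (interp (LR μ 𝕜 p₀ r₀ b₀ q₀ a₀) (Linf μ 𝕜) 1 r a).Same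
          (LK μ 𝕜 ∞ r (a ∘ ρ)))) ∧
    -- the couple `(L^{p₀),q₀,r₀}_{b₀}, L_∞)` with the grand Lorentz–Karamata space
    (∀ χ ρ : ℝ → ℝ, χ = headNorm r₀ b₀ → ρ = rho p₀ χ →
      (lqNorm r (Ioi 1) (weight (-recip r) a) < ∞ →
        (interp (grandLK μ 𝕜 p₀ q₀ r₀ b₀) (Linf μ 𝕜) 0 r a).Same
          (LRL μ 𝕜 p₀ r (a ∘ ρ) r₀ b₀ q₀ (fun _ => 1))) ∧
      (∀ (θ : ℝ) (p : ℝ≥0∞), 0 < θ → θ < 1 → p⁻¹ = ENNReal.ofReal (1 - θ) / p₀ →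
        (interp (grandLK μ 𝕜 p₀ q₀ r₀ b₀) (Linf μ 𝕜) θ r a).Same
          (LK μ 𝕜 p r (fun t => χ t ^ (1 - θ) * a (ρ t)))) ∧
      (lqNorm r (Ioo 0 1) (weight (-recip r) a) < ∞ →
        (interp (grandLK μ 𝕜 p₀ q₀ r₀ b₀) (Linf μ 𝕜) 1 r a).Same
          (LK μ 𝕜 ∞ r (a ∘ ρ)))) := by
  have top : recip ∞ = (1 - 1) * recip p₀ := by rw [recip_top, sub_self, zero_mul]
  constructor
  · intro χ ρ hχ hρ
    obtain ⟨h₀, h₁⟩ := interp_LR_Linf_same μ 𝕜 hp₀ hp₀' hr hr₀ hq₀ ha ha₀ hb₀ hb₀' hχ hρ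
    refine ⟨fun _ => h₀, fun θ p hθ hθ' hp => h₁ θ p hθ (recip_eq_of_inv_eq hθ' hp), fun _ => ?_⟩
    -- At `θ = 1` the factor `χ ^ (1 - θ)` is `1`, leaving `a ∘ ρ`.
    simpa [Function.comp_def] using h₁ 1 ∞ one_pos top
  · intro χ ρ hχ hρ
    -- The grand space is the `𝓡` space with `a₀ = 1`, and `χ` is read accordingly.
    rw [← chi_one] at hχ
    rw [grandLK_eq]
    obtain ⟨h₀, h₁⟩ :=
      interp_LR_Linf_same μ 𝕜 hp₀ hp₀' hr hr₀ hq₀ ha slowlyVarying_one hb₀ hb₀' hχ hρ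
    refine ⟨fun _ => h₀, fun θ p hθ hθ' hp => h₁ θ p hθ (recip_eq_of_inv_eq hθ' hp), fun _ => ?_⟩
    simpa [Function.comp_def] using h₁ 1 ∞ one_pos top
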